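/- A rooted plane curve with \(n\ge 1\) crossings is a triple \((\sigma,\tau,a)\) consisting of two permutations \(\sigma,\tau\) of a set of \(4n\) flags and a root flag \(a\), considered up to relabelling of the flags, such that \(\sigma\) is a product of \(n\) disjoint \(4\)-cycles (the vertices), \(\tau\) is a product of \(2n\) disjoint transpositions (the edges), the group generated by \(\sigma\) and \(\tau\) acts transitively on the flags (connectedness), \(\sigma\tau\) has exactly \(n+2\) cycles, fixed points included (planarity), and \(\sigma^2\tau\) has exactly two cycles (the map is traced by a single closed curve, one cycle for each orientation). The cycles of \(\sigma\tau\) are the faces of the curve, and the degree of a face is the length of its cycle. **Theorem.** Let \(p_{n,k}\) denote the probability that a uniformly random face of a uniformly random rooted plane curve with \(n\) crossings has degree \(k\). Let \(k\ge 1\). Then, for every \(n\ge1\), \((n+2)\,p_{n,k}\) is the expected number of faces of degree \(k\) of a uniformly random rooted plane curve with \(n\) crossings, and \[ 0<\liminf_{n\to\infty}p_{n,k}\le\limsup_{n\to\infty}p_{n,k}<1 . \] -/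

import Mathlib

open Filter
open scoped BigOperators

/-- A plane curve with `n` vertices whose `4 n` flags are labelled by `Fin (4 * n)`, together with
a root flag, given as a combinatorial map: `σ` permutes the four flags around each vertex
counterclockwise, and `τ` exchanges the two flags of each edge.

For a permutation `π` of a finite type, `π.partition.parts` is the multiset of the lengths of
*all* cycles of `π`, fixed points included (as cycles of length one). -/
structure LabelledCurve (n : ℕ) where
  /-- the vertex permutation -/
  σ : Equiv.Perm (Fin (4 * n))
  /-- the edge permutation -/
  τ : Equiv.Perm (Fin (4 * n))
  /-- the root flag, that is, an edge with a direction -/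
  root : Fin (4 * n)
  /-- `σ` is a product of `n` disjoint cycles of length 4 -/
  vertices : σ.cycleType = Multiset.replicate n 4
  /-- `τ` is a product of `2 n` disjoint cycles of length 2 -/
  edges : τ.cycleType = Multiset.replicate (2 * n) 2
  /-- the underlying graph is connected -/
  connected : MulAction.IsPretransitive (Subgroup.closure {σ, τ}) (Fin (4 * n))
  /-- planarity (Euler's formula): there are `n + 2` faces, the faces being the cycles of `σ τ` -/
  planar : Multiset.card (σ * τ).partition.parts = n + 2
  /-- the map is traced by a single closed curve: `σ² τ` has exactly two cycles, one for each
  orientation of the curve -/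
  curve : Multiset.card (σ ^ 2 * τ).partition.parts = 2

namespace LabelledCurve

/-- Two labelled rooted plane curves are the same rooted plane curve if a relabelling of the flags
carries the vertices, edges and root of one to those of the other. -/
def Iso {n : ℕ} (C D : LabelledCurve n) : Prop :=
  ∃ g : Equiv.Perm (Fin (4 * n)),
    D.σ = g * C.σ * g⁻¹ ∧ D.τ = g * C.τ * g⁻¹ ∧ D.root = g C.root

instance setoid (n : ℕ) : Setoid (LabelledCurve n) where
  r := Iso
  iseqv :=
    { refl := fun C => ⟨1, by simp, by simp, by simp⟩
      symm := by
        rintro C D ⟨g, h1, h2, h3⟩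
        refine ⟨g⁻¹, ?_, ?_, ?_⟩
        · rw [h1]; group
        · rw [h2]; group
        · rw [h3]; simp
      trans := by
        rintro C D E ⟨g, h1, h2, h3⟩ ⟨h, k1, k2, k3⟩
        refine ⟨h * g, ?_, ?_, ?_⟩
        · rw [k1, h1]; group
        · rw [k2, h2]; group
        · rw [k3, h3]; simp }

instance finite (n : ℕ) : Finite (LabelledCurve n) :=
  Finite.of_injective
    (fun C : LabelledCurve n => (C.σ, C.τ, C.root)) (by
      rintro ⟨σ, τ, r, _⟩ ⟨σ', τ', r', _⟩ h
      simp only [Prod.mk.injEq] at h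
      obtain ⟨rfl, rfl, rfl⟩ := h
      rfl)

/-- The multiset of the degrees of the faces: the lengths of all cycles of `σ τ`. -/
def faceDegrees {n : ℕ} (C : LabelledCurve n) : Multiset ℕ := (C.σ * C.τ).partition.parts

theorem faceDegrees_eq {n : ℕ} {C D : LabelledCurve n} (h : Iso C D) :
    C.faceDegrees = D.faceDegrees := by
  obtain ⟨g, h1, h2, -⟩ := h
  unfold faceDegrees
  have hc : IsConj (C.σ * C.τ) (D.σ * D.τ) := by
    rw [isConj_iff]
    exact ⟨g, by rw [h1, h2]; group⟩
  rw [Equiv.Perm.partition_eq_of_isConj.1 hc]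

end LabelledCurve

/-- The rooted plane curves with `n` vertices (crossings). -/
def RootedPlaneCurve (n : ℕ) : Type := Quotient (LabelledCurve.setoid n)

namespace RootedPlaneCurve

instance finite (n : ℕ) : Finite (RootedPlaneCurve n) :=
  inferInstanceAs (Finite (Quotient (LabelledCurve.setoid n)))

noncomputable instance fintype (n : ℕ) : Fintype (RootedPlaneCurve n) := Fintype.ofFinite _

/-- The multiset of the degrees of the faces of a rooted plane curve. -/
def faceDegrees {n : ℕ} (D : RootedPlaneCurve n) : Multiset ℕ :=
  Quotient.lift LabelledCurve.faceDegrees (fun _ _ h => LabelledCurve.faceDegrees_eq h) D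

/-- The number of faces of degree `k`. -/
def faceCount {n : ℕ} (D : RootedPlaneCurve n) (k : ℕ) : ℕ := D.faceDegrees.count k

/-- The total number of faces. -/
def numFaces {n : ℕ} (D : RootedPlaneCurve n) : ℕ := Multiset.card D.faceDegrees

/-- The expected number of faces of degree `k` of a uniformly random rooted plane curve with `n`
crossings. -/
noncomputable def expectedFaceCount (n k : ℕ) : ℝ :=
  Finset.expect Finset.univ fun D : RootedPlaneCurve n => (D.faceCount k : ℝ)

/-- The probability that a uniformly random face of a uniformly random rooted plane curve with `n`
crossings has degree `k`: the average over all curves of the proportion of faces of degree `k`. -/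
noncomputable def faceProb (n k : ℕ) : ℝ :=
  Finset.expect Finset.univ fun D : RootedPlaneCurve n => (D.faceCount k : ℝ) / (D.numFaces : ℝ)

end RootedPlaneCurve

/-!
A curve with `n` crossings has `4 n` flags and `n + 2` faces, so the average over the crossings of
`∑ 1 / deg`, taken over the faces of the four flags at the crossing, exceeds `1`.

Call a crossing detachable if, up to changing boundedly many edges near it, it can be removed so as
to leave a curve with one crossing less. Smoothing a crossing compatibly with the traversal leaves
a single closed curve, and by Euler's formula it merges two distinct opposite faces; the change is
recovered from bounded information when one of these faces has degree at most `12`. A crossing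
with a loop is detachable by a Reidemeister move of the first kind. At any other crossing that is
not detachable two opposite faces have degree at least `13`, so the sum there is at most `77 / 78`,
unless the crossing lies between two bigons; a chain of bigons is shortened by a move of the second
kind. Hence a positive proportion of the crossings is detachable.

Reattach a detached crossing as a kink on a side of a simple face of degree `j`: that face becomes
a simple face of degree `j + 1`, the kink itself is a face of degree `1`, and the operation is
boundedly-many-to-one. By induction on `j` the faces of every degree have positive density, and two
degrees share the total mass `1`, so no degree has density `1`.
-/

namespace PlaneCurve

open Equiv Equiv.Perm

section Cycles

variable {F : Type*}

/-- The set of cycles of a permutation, fixed points included. -/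
abbrev Cycles (φ : Perm F) : Type _ := Quotient (SameCycle.setoid φ)

/-- The cycle of a permutation that contains a given point. -/
abbrev cycleAt (φ : Perm F) (x : F) : Cycles φ := Quotient.mk (SameCycle.setoid φ) x

/-- The number of cycles of a permutation, fixed points included. -/
noncomputable def numCycles (φ : Perm F) : ℕ := Nat.card (Cycles φ)

theorem cycleAt_eq_cycleAt {φ : Perm F} {x y : F} :
    cycleAt φ x = cycleAt φ y ↔ SameCycle φ x y := Quotient.eq

theorem cycleAt_apply (φ : Perm F) (x : F) : cycleAt φ (φ x) = cycleAt φ x :=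
  cycleAt_eq_cycleAt.2 (sameCycle_apply_left.2 (SameCycle.refl φ x))

theorem eq_of_sameCycle_of_invariant {φ : Perm F} {β : Type*} {f : F → β}
    (hf : ∀ x, f (φ x) = f x) {x y : F} (h : SameCycle φ x y) : f x = f y := by
  obtain ⟨k, rfl⟩ := h
  induction k using Int.induction_on with
  | zero => rfl
  | succ i ih => rw [add_comm, zpow_one_add, Perm.mul_apply, hf, ih]
  | pred i ih =>
    rw [ih, ← hf ((φ ^ (-(i : ℤ) - 1)) x), ← Perm.mul_apply, ← zpow_one_add, add_sub_cancel]

theorem card_le_numCycles_of_surjective [Finite F] {φ : Perm F} {β : Type*} {f : F → β}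
    (hf : ∀ x, f (φ x) = f x) (hs : Function.Surjective f) : Nat.card β ≤ numCycles φ :=
  Nat.card_le_card_of_surjective (Quotient.lift f fun _ _ => eq_of_sameCycle_of_invariant hf)
    (Quotient.lift_surjective _ _ hs)

variable [DecidableEq F]

theorem invariant_swap_mul {φ : Perm F} {β : Type*} {f : F → β} (hf : ∀ z, f (φ z) = f z)
    {x y : F} (hxy : f x = f y) (z : F) : f ((swap x y * φ) z) = f z := by
  rw [Perm.mul_apply, swap_apply_def, ← hf z]
  split_ifs with h1 h2
  · rw [h1, hxy]
  · rw [h2, hxy]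
  · rfl

theorem numCycles_le_numCycles_swap_mul [Finite F] {φ : Perm F} {x y : F}
    (h : SameCycle φ x y) : numCycles φ ≤ numCycles (swap x y * φ) :=
  card_le_numCycles_of_surjective
    (invariant_swap_mul (cycleAt_apply φ) (cycleAt_eq_cycleAt.2 h)) Quotient.mk_surjective

theorem numCycles_le_numCycles_swap_mul_add_one [Finite F] (φ : Perm F) (x y : F) :
    numCycles φ ≤ numCycles (swap x y * φ) + 1 := by
  classical
  by_cases h : cycleAt φ x = cycleAt φ y
  · exact (numCycles_le_numCycles_swap_mul (cycleAt_eq_cycleAt.1 h)).trans (Nat.le_succ _)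
  let merge : F → {c : Cycles φ // c ≠ cycleAt φ y} := fun z =>
    if hz : cycleAt φ z = cycleAt φ y then ⟨cycleAt φ x, h⟩ else ⟨cycleAt φ z, hz⟩
  have hmerge : Nat.card {c : Cycles φ // c ≠ cycleAt φ y} ≤ numCycles (swap x y * φ) := by
    refine card_le_numCycles_of_surjective (f := merge)
      (invariant_swap_mul (fun z => ?_) ?_) ?_
    · simp only [merge, cycleAt_apply]
    · simp [merge, h]
    · rintro ⟨⟨z⟩, hc⟩
      exact ⟨z, dif_neg hc⟩
  rw [numCycles, ← Nat.card_congr (Equiv.optionSubtypeNe (cycleAt φ y)), Finite.card_option]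
  exact Nat.succ_le_succ hmerge

theorem numCycles_add_one_le_numCycles_swap_apply_mul [Finite F] {φ : Perm F} {p : F}
    (hp : φ p ≠ p) : numCycles φ + 1 ≤ numCycles (swap p (φ p) * φ) := by
  classical
  rw [numCycles, ← Finite.card_option]
  refine card_le_numCycles_of_surjective
    (f := fun z => if z = p then none else some (cycleAt φ z)) (fun z => ?_) ?_
  · have hinj : φ z = φ p ↔ z = p := φ.injective.eq_iff
    have hcycle : φ z = p → cycleAt φ (φ p) = cycleAt φ z := by
      rintro rfl
      rw [cycleAt_apply, cycleAt_apply]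
    rw [Perm.mul_apply, swap_apply_def]
    split_ifs <;> simp_all [cycleAt_apply]
  · rintro (_ | ⟨⟨z⟩⟩)
    · exact ⟨p, if_pos rfl⟩
    · by_cases hz : z = p
      · subst hz
        exact ⟨φ z, (if_neg hp).trans (congrArg some (cycleAt_apply φ z))⟩
      · exact ⟨z, if_neg hz⟩

end Cycles

section CycleLengths

variable {F : Type*}

theorem minimalPeriod_pos [Finite F] (φ : Perm F) (x : F) : 0 < Function.minimalPeriod φ x :=
  Function.minimalPeriod_pos_of_mem_periodicPts (φ.injective.mem_periodicPts x)

theorem ncard_sameCycle [Finite F] (φ : Perm F) (x : F) :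
    {y | SameCycle φ x y}.ncard = Function.minimalPeriod φ x := by
  have himage : {y | SameCycle φ x y} =
      (fun m => φ^[m] x) '' Set.Iio (Function.minimalPeriod φ x) := by
    ext y
    constructor
    · intro h
      obtain ⟨i, rfl⟩ := h.exists_nat_pow_eq
      refine ⟨i % Function.minimalPeriod φ x, Nat.mod_lt _ (minimalPeriod_pos φ x), ?_⟩
      simp only [Function.iterate_mod_minimalPeriod_eq, iterate_eq_pow]
    · rintro ⟨i, -, rfl⟩
      exact ⟨i, by rw [zpow_natCast, ← iterate_eq_pow]⟩
  rw [himage, Function.iterate_injOn_Iio_minimalPeriod.ncard_image,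
    Set.ncard_eq_toFinset_card', Set.toFinset_Iio, Nat.card_Iio]

theorem minimalPeriod_eq_of_sameCycle [Finite F] {φ : Perm F} {x y : F} (h : SameCycle φ x y) :
    Function.minimalPeriod φ x = Function.minimalPeriod φ y := by
  rw [← ncard_sameCycle, ← ncard_sameCycle]
  congr 1
  ext z
  exact ⟨h.symm.trans, h.trans⟩

theorem sum_inv_minimalPeriod [Fintype F] (φ : Perm F) :
    ∑ x, (1 : ℚ) / Function.minimalPeriod φ x = numCycles φ := by
  classical
  have := Fintype.ofFinite (Cycles φ)
  suffices hone : ∀ c : Cycles φ,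
      ∑ x with cycleAt φ x = c, (1 : ℚ) / Function.minimalPeriod φ x = 1 by
    rw [← Finset.sum_fiberwise (g := cycleAt φ), Finset.sum_congr rfl fun c _ => hone c]
    simp [numCycles]
  refine Quotient.ind fun x => ?_
  have hconst : ∀ y ∈ Finset.univ.filter (cycleAt φ · = cycleAt φ x),
      (1 : ℚ) / Function.minimalPeriod φ y = 1 / Function.minimalPeriod φ x := fun y hy => by
    rw [minimalPeriod_eq_of_sameCycle (cycleAt_eq_cycleAt.1 (Finset.mem_filter.1 hy).2)]
  have hcard : (Finset.univ.filter (cycleAt φ · = cycleAt φ x)).card =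
      Function.minimalPeriod φ x := by
    rw [← ncard_sameCycle, ← Set.ncard_coe_finset]
    congr 1
    ext y
    simp only [Finset.coe_filter, Finset.mem_univ, true_and, Set.mem_ofPred_eq]
    rw [cycleAt_eq_cycleAt, sameCycle_comm]
  rw [Finset.sum_congr rfl hconst, Finset.sum_const, hcard, nsmul_eq_mul]
  exact mul_one_div_cancel (Nat.cast_ne_zero.2 (minimalPeriod_pos φ x).ne')

variable [Fintype F] [DecidableEq F]

theorem card_support_cycleOf {φ : Perm F} {x : F} (hx : x ∈ φ.support) :
    (φ.cycleOf x).support.card = Function.minimalPeriod φ x := by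
  rw [← ncard_sameCycle, ← Set.ncard_coe_finset]
  congr 1
  ext y
  rw [Finset.mem_coe, mem_support_cycleOf_iff]
  exact ⟨And.left, fun h => ⟨h, hx⟩⟩

theorem mul_count_cycleType (φ : Perm F) (k : ℕ) :
    k * φ.cycleType.count k =
      (φ.support.filter fun x => Function.minimalPeriod φ x = k).card := by
  have hunion : (φ.support.filter fun x => Function.minimalPeriod φ x = k) =
      (φ.cycleFactorsFinset.filter fun c => k = c.support.card).biUnion support := by
    ext x
    simp only [Finset.mem_filter, Finset.mem_biUnion]
    constructor
    · rintro ⟨hx, rfl⟩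
      exact ⟨φ.cycleOf x, ⟨cycleOf_mem_cycleFactorsFinset_iff.2 hx, (card_support_cycleOf hx).symm⟩,
        mem_support_cycleOf_iff.2 ⟨SameCycle.refl φ x, hx⟩⟩
    · rintro ⟨c, ⟨hc, rfl⟩, hxc⟩
      have hx := mem_cycleFactorsFinset_support_le hc hxc
      rw [(eq_cycleOf_of_mem_cycleFactorsFinset_iff φ c hc x).2 hxc]
      exact ⟨hx, (card_support_cycleOf hx).symm⟩
  have hdisj :
      (φ.cycleFactorsFinset.filter fun c => k = c.support.card : Set (Perm F)).PairwiseDisjoint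
        support := fun c hc d hd hcd => disjoint_iff_disjoint_support.1
    (cycleFactorsFinset_pairwise_disjoint φ (Finset.mem_filter.1 hc).1 (Finset.mem_filter.1 hd).1
      hcd)
  rw [hunion, Finset.card_biUnion hdisj,
    Finset.sum_const_nat fun c hc => (Finset.mem_filter.1 hc).2.symm, cycleType_def,
    Multiset.count_map, ← Finset.filter_val, Finset.card_val, mul_comm]
  rfl

theorem mul_count_partition (φ : Perm F) (k : ℕ) :
    k * φ.partition.parts.count k =
      (Finset.univ.filter fun x => Function.minimalPeriod φ x = k).card := by
  have hfix : k * (Multiset.replicate (Fintype.card F - φ.support.card) 1).count k =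
      (φ.supportᶜ.filter fun x => Function.minimalPeriod φ x = k).card := by
    have hone : ∀ x ∈ φ.supportᶜ, Function.minimalPeriod φ x = 1 := fun x hx =>
      Function.minimalPeriod_eq_one_iff_isFixedPt.2 (notMem_support.1 (Finset.mem_compl.1 hx))
    rw [Finset.filter_congr fun x hx => by rw [hone x hx], Finset.filter_const,
      Multiset.count_replicate]
    split_ifs with hk
    · rw [← hk, one_mul, Finset.card_compl]
    · rw [mul_zero, Finset.card_empty]
  rw [parts_partition, Multiset.count_add, mul_add, mul_count_cycleType, hfix,
    ← Finset.card_union_of_disjoint (Finset.disjoint_filter_filter disjoint_compl_right),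
    ← Finset.filter_union, Finset.union_compl]

theorem mem_parts_partition_iff {φ : Perm F} {k : ℕ} :
    k ∈ φ.partition.parts ↔ ∃ x, Function.minimalPeriod φ x = k := by
  have hcount := mul_count_partition φ k
  constructor
  · intro hk
    have hpos := Nat.mul_pos (φ.partition.parts_pos hk) (Multiset.count_pos.2 hk)
    rw [hcount, Finset.card_pos] at hpos
    obtain ⟨x, hx⟩ := hpos
    exact ⟨x, (Finset.mem_filter.1 hx).2⟩
  · rintro ⟨x, hx⟩
    refine Multiset.count_pos.1 (Nat.pos_of_mul_pos_left (a := k) ?_)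
    rw [hcount]
    exact Finset.card_pos.2 ⟨x, Finset.mem_filter.2 ⟨Finset.mem_univ x, hx⟩⟩

theorem card_parts_partition (φ : Perm F) :
    Multiset.card φ.partition.parts = numCycles φ := by
  have hfiber : ∀ k ∈ φ.partition.parts.toFinset,
      ∑ x with Function.minimalPeriod φ x = k, (1 : ℚ) / Function.minimalPeriod φ x =
        φ.partition.parts.count k := by
    intro k hk
    have hk0 : (k : ℚ) ≠ 0 :=
      Nat.cast_ne_zero.2 (φ.partition.parts_pos (Multiset.mem_toFinset.1 hk)).ne'
    rw [Finset.sum_congr rfl (g := fun _ => (1 : ℚ) / k)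
      fun x hx => by rw [(Finset.mem_filter.1 hx).2], Finset.sum_const, ← mul_count_partition,
      nsmul_eq_mul, Nat.cast_mul]
    field_simp
  have hsum := sum_inv_minimalPeriod φ
  rw [← Finset.sum_fiberwise_of_maps_to fun x _ =>
      Multiset.mem_toFinset.2 (mem_parts_partition_iff.2 ⟨x, rfl⟩),
    Finset.sum_congr rfl hfiber, ← Nat.cast_sum, Multiset.toFinset_sum_count_eq] at hsum
  exact_mod_cast hsum

theorem cycleType_eq_replicate_iff {φ : Perm F} {m d : ℕ} (hd : 2 ≤ d)
    (hF : Fintype.card F = d * m) :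
    φ.cycleType = Multiset.replicate m d ↔ ∀ x, Function.minimalPeriod φ x = d := by
  constructor
  · intro h x
    have hsupport : φ.support.card = Fintype.card F := by
      rw [← sum_cycleType φ, h, Multiset.sum_replicate, smul_eq_mul, hF, mul_comm]
    have hx : Function.minimalPeriod φ x ∈ φ.partition.parts :=
      mem_parts_partition_iff.2 ⟨x, rfl⟩
    rw [parts_partition, hsupport, Nat.sub_self, Multiset.replicate_zero, add_zero, h] at hx
    exact Multiset.eq_of_mem_replicate hx
  · intro h
    have hparts : φ.partition.parts = Multiset.replicate (Multiset.card φ.partition.parts) d :=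
      Multiset.eq_replicate_card.2 fun k hk => by
        obtain ⟨x, rfl⟩ := mem_parts_partition_iff.1 hk
        exact h x
    have hcard : Multiset.card φ.partition.parts = m := by
      have hsum := φ.partition.parts_sum
      rw [hparts, Multiset.sum_replicate, smul_eq_mul] at hsum
      exact Nat.eq_of_mul_eq_mul_right (by omega) (hsum.trans (hF.trans (mul_comm d m)))
    rw [← filter_parts_partition_eq_cycleType, hparts, hcard]
    exact Multiset.filter_eq_self.2 fun k hk => by rwa [Multiset.eq_of_mem_replicate hk]

end CycleLengths

section Pairings

variable {F : Type*}

/-- A fixed-point-free involution, such as the exchange of the two flags of each edge. -/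
structure IsPairing (τ : Perm F) : Prop where
  apply_ne : ∀ x, τ x ≠ x
  apply_apply : ∀ x, τ (τ x) = x

theorem isPairing_iff_minimalPeriod {τ : Perm F} :
    IsPairing τ ↔ ∀ x, Function.minimalPeriod τ x = 2 := by
  simp only [Function.minimalPeriod_eq_prime_iff]
  exact ⟨fun h x => ⟨h.apply_apply x, h.apply_ne x⟩, fun h => ⟨fun x => (h x).2, fun x => (h x).1⟩⟩

namespace IsPairing

variable {s τ : Perm F}

theorem apply_eq_iff (h : IsPairing τ) {x y : F} : τ x = y ↔ x = τ y := by
  rw [← h.apply_apply y, τ.injective.eq_iff, h.apply_apply]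

theorem inv_eq (h : IsPairing τ) : τ⁻¹ = τ := by
  ext x
  rw [Perm.inv_eq_iff_eq, h.apply_apply]

theorem conj (h : IsPairing τ) (g : Perm F) : IsPairing (g * τ * g⁻¹) where
  apply_ne x hx := h.apply_ne (g⁻¹ x) (Perm.eq_inv_iff_eq.2 hx)
  apply_apply x := by simp [h.apply_apply]

theorem apply_zpow_mul (hs : IsPairing s) (hτ : IsPairing τ) (k : ℤ) (x : F) :
    τ (((s * τ) ^ k) x) = ((s * τ) ^ (-k)) (τ x) := by
  have h : SemiconjBy τ (s * τ) (s * τ)⁻¹ := by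
    rw [SemiconjBy, mul_inv_rev, hs.inv_eq, hτ.inv_eq, mul_assoc]
  rw [zpow_neg, ← inv_zpow]
  exact DFunLike.congr_fun (h.zpow_right k).eq x

theorem not_sameCycle_apply_right (hs : IsPairing s) (hτ : IsPairing τ) (x : F) :
    ¬ SameCycle (s * τ) x (τ x) := by
  rintro ⟨k, hk⟩
  rcases Int.even_or_odd' k with ⟨j, rfl | rfl⟩
  · apply hτ.apply_ne (((s * τ) ^ j) x)
    rw [hs.apply_zpow_mul hτ, ← hk, ← Perm.mul_apply, ← zpow_add]
    congr 2
    ring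
  · apply hs.apply_ne (((s * τ) ^ (j + 1)) x)
    have hsτ : s (((s * τ) ^ (j + 1)) x) = (s * τ) (τ (((s * τ) ^ (j + 1)) x)) := by
      rw [Perm.mul_apply, hτ.apply_apply]
    rw [hsτ, hs.apply_zpow_mul hτ, ← hk, ← Perm.mul_apply, ← Perm.mul_apply, ← zpow_one_add,
      ← zpow_add]
    congr 2
    ring

theorem sameCycle_apply_left_iff (hτ : IsPairing τ) {x y : F} :
    SameCycle (s * τ) x (s y) ↔ SameCycle (s * τ) x (τ y) := by
  rw [← sameCycle_apply_right (x := x) (y := τ y), Perm.mul_apply, hτ.apply_apply]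

theorem not_sameCycle_apply_left (hs : IsPairing s) (hτ : IsPairing τ) (x : F) :
    ¬ SameCycle (s * τ) x (s x) := by
  rw [hτ.sameCycle_apply_left_iff]
  exact hs.not_sameCycle_apply_right hτ x

theorem sameCycle_apply_apply (hs : IsPairing s) (hτ : IsPairing τ) {x y : F}
    (h : SameCycle (s * τ) x y) : SameCycle (s * τ) (τ x) (τ y) := by
  obtain ⟨k, rfl⟩ := h
  exact ⟨-k, (hs.apply_zpow_mul hτ k x).symm⟩

theorem sameCycle_apply_comm (hs : IsPairing s) (hτ : IsPairing τ) {x y : F} :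
    SameCycle (s * τ) x (τ y) ↔ SameCycle (s * τ) (τ x) y :=
  ⟨fun h => by simpa only [hτ.apply_apply] using hs.sameCycle_apply_apply hτ h,
    fun h => by simpa only [hτ.apply_apply] using hs.sameCycle_apply_apply hτ h⟩

end IsPairing

/-- The flags in `A` lie on a single strand alternating between `s` and `τ`: every property that
`s` and `τ` preserve on `A` holds for all flags in `A` or for none. The set `A` is not required to
be invariant. -/
def JoinedOn (A : Set F) (s τ : F → F) : Prop :=
  ∀ f : F → Prop, (∀ x ∈ A, (f (s x) ↔ f x)) → (∀ x ∈ A, (f (τ x) ↔ f x)) →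
    ∀ x ∈ A, ∀ y ∈ A, f x → f y

theorem JoinedOn.apply_ne {s τ : Perm F} (hτ : IsPairing τ) {A : Set F} {p q : F}
    (hj : JoinedOn A s τ) (hp : p ∈ A) (hsp : s p = q) (hsq : s q = p) (hA : ¬ A ⊆ {p, q}) :
    τ p ≠ q := by
  rintro rfl
  refine hA fun y hy => hj (· ∈ ({p, τ p} : Set F)) (fun x _ => ?_) (fun x _ => ?_) p hp y hy
    (by simp)
  · constructor
    · rintro (e | e)
      · exact Or.inr (s.injective (e.trans hsq.symm))
      · exact Or.inl (s.injective (e.trans hsp.symm))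
    · rintro (rfl | rfl)
      · exact Or.inr hsp
      · exact Or.inl hsq
  · simp only [Set.mem_insert_iff, Set.mem_singleton_iff, τ.injective.eq_iff, hτ.apply_eq_iff]
    exact or_comm

/-- Arcs of the strand can be removed if `τ'` joins the two ends of each of them; here `r` assigns
to each removed flag one of the ends of its arc. -/
theorem JoinedOn.sdiff {s τ τ' r : F → F} {A S : Set F} (hj : JoinedOn A s τ)
    (hττ : ∀ x, τ (τ x) = x) (hr : ∀ z ∈ S, r z ∈ A \ S)
    (hsS : ∀ z, s z ∈ S ↔ z ∈ S) (hrs : ∀ z ∈ S, r (s z) = r z)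
    (hend : ∀ z ∈ S, τ z ∈ S ∧ r (τ z) = r z ∨ τ z ∉ S ∧ (τ z = r z ∨ τ z = τ' (r z)))
    (hoff : ∀ z ∈ A \ S, τ z ∉ S → τ' z = τ z) : JoinedOn (A \ S) s τ' := by
  classical
  intro f hfs hfτ x hx y hy hfx
  let g : F → Prop := fun z => f (if z ∈ S then r z else z)
  have hgS : ∀ {z}, z ∈ S → (g z ↔ f (r z)) := fun hz => by simp only [g, if_pos hz]
  have hgA : ∀ {z}, z ∉ S → (g z ↔ f z) := fun hz => by simp only [g, if_neg hz]
  have hgs : ∀ z ∈ A, (g (s z) ↔ g z) := fun z hz => by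
    by_cases hzS : z ∈ S
    · rw [hgS hzS, hgS ((hsS z).2 hzS), hrs z hzS]
    · rw [hgA hzS, hgA (mt (hsS z).1 hzS), hfs z ⟨hz, hzS⟩]
  have hgτS : ∀ z ∈ S, (g (τ z) ↔ g z) := fun z hz => by
    rw [hgS hz]
    rcases hend z hz with ⟨hτz, hrz⟩ | ⟨hτz, hτr | hτr⟩
    · rw [hgS hτz, hrz]
    · rw [hgA hτz, hτr]
    · rw [hgA hτz, hτr, hfτ _ (hr z hz)]
  have hgτ : ∀ z ∈ A, (g (τ z) ↔ g z) := fun z hz => by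
    by_cases hzS : z ∈ S
    · exact hgτS z hzS
    by_cases hτzS : τ z ∈ S
    · have hg := hgτS _ hτzS
      rwa [hττ, Iff.comm] at hg
    · rw [hgA hzS, hgA hτzS, ← hoff z ⟨hz, hzS⟩ hτzS, hfτ z ⟨hz, hzS⟩]
  exact (hgA hy.2).1 (hj g hgs hgτ x hx.1 y hy.1 ((hgA hx.2).2 hfx))

theorem JoinedOn.congr {s s' τ τ' : F → F} {A : Set F} (hj : JoinedOn A s τ)
    (hs : ∀ x ∈ A, s' x = s x) (hτ : ∀ x ∈ A, τ' x = τ x) : JoinedOn A s' τ' :=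
  fun f hfs hfτ => hj f (fun x hx => hs x hx ▸ hfs x hx) fun x hx => hτ x hx ▸ hfτ x hx

theorem JoinedOn.sameCycle_or_sameCycle_apply {s τ : Perm F} (hs : IsPairing s) (hτ : IsPairing τ)
    (h : JoinedOn Set.univ s τ) (x y : F) :
    SameCycle (s * τ) x y ∨ SameCycle (s * τ) (τ x) y := by
  have hinv : ∀ z, SameCycle (s * τ) x (τ z) ∨ SameCycle (s * τ) (τ x) (τ z) ↔
      SameCycle (s * τ) x z ∨ SameCycle (s * τ) (τ x) z := fun z => by
    rw [hs.sameCycle_apply_comm hτ, hs.sameCycle_apply_comm hτ, hτ.apply_apply, or_comm]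
  refine h (fun z => SameCycle (s * τ) x z ∨ SameCycle (s * τ) (τ x) z) (fun z _ => ?_)
    (fun z _ => hinv z) x trivial y trivial (Or.inl (SameCycle.refl _ _))
  rw [hτ.sameCycle_apply_left_iff, hτ.sameCycle_apply_left_iff]
  exact hinv z

/-- The two cycles are the two orientations of the strand. -/
theorem joinedOn_univ_iff_numCycles_eq_two [Finite F] [Nonempty F] {s τ : Perm F}
    (hs : IsPairing s) (hτ : IsPairing τ) :
    JoinedOn Set.univ s τ ↔ numCycles (s * τ) = 2 := by
  have hne : ∀ x, cycleAt (s * τ) (τ x) ≠ cycleAt (s * τ) x := fun x hx =>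
    hs.not_sameCycle_apply_right hτ x (cycleAt_eq_cycleAt.1 hx.symm)
  obtain ⟨x⟩ := ‹Nonempty F›
  constructor
  · intro h
    refine (Nat.card_eq_two_iff' (cycleAt (s * τ) x)).2 ⟨cycleAt (s * τ) (τ x), hne x, ?_⟩
    refine Quotient.ind fun z hz => ?_
    rcases h.sameCycle_or_sameCycle_apply hs hτ x z with hxz | hxz
    · exact absurd (cycleAt_eq_cycleAt.2 hxz.symm) hz
    · exact cycleAt_eq_cycleAt.2 hxz.symm
  · intro h f hfs hfτ x _ y _ hx
    have hf : ∀ z, f ((s * τ) z) = f z := fun z =>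
      propext ((hfs (τ z) trivial).trans (hfτ z trivial))
    by_cases hxy : SameCycle (s * τ) x y
    · rwa [← eq_of_sameCycle_of_invariant hf hxy]
    · have hy : cycleAt (s * τ) y = cycleAt (s * τ) (τ x) :=
        ((Nat.card_eq_two_iff' (cycleAt (s * τ) x)).1 h).unique
          (fun hy => hxy (cycleAt_eq_cycleAt.1 hy.symm)) (hne x)
      rw [eq_of_sameCycle_of_invariant hf (cycleAt_eq_cycleAt.1 hy)]
      exact (hfτ x trivial).2 hx

/-- A smoothing that respects the orientation of a single strand glues two of its pieces the other
way round, so that every property invariant under the new gluing propagates along the piece from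
`s a` back to `a`. -/
theorem iff_of_sameCycle [Finite F] {s s' τ : Perm F} {f : F → Prop} (hs : IsPairing s)
    (hτ : IsPairing τ) {a b : F} (hab : SameCycle (s * τ) a b) (ha : s' a = b)
    (hoff : ∀ z, z ≠ a → z ≠ b → z ≠ s a → z ≠ s b → s' z = s z)
    (hf : ∀ x, f (s' x) ↔ f x) (hfτ : ∀ x, f (τ x) ↔ f x) : f (s a) ↔ f a := by
  let S : Set F := {x | SameCycle (s * τ) a x ∧ (f x ↔ f a)}
  have hS : Set.MapsTo (s * τ) S S := by
    rintro x ⟨hax, hfx⟩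
    have hax' : SameCycle (s * τ) a ((s * τ) x) := sameCycle_apply_right.2 hax
    refine ⟨hax', ?_⟩
    by_cases hxa : (s * τ) x = a
    · rw [hxa]
    by_cases hxb : (s * τ) x = b
    · rw [hxb, ← ha, hf]
    have hxsa : (s * τ) x ≠ s a := fun e => hs.not_sameCycle_apply_left hτ a (e ▸ hax')
    have hxsb : (s * τ) x ≠ s b := fun e =>
      hs.not_sameCycle_apply_left hτ b (hab.symm.trans (e ▸ hax'))
    rw [← hf, hoff _ hxa hxb hxsa hxsb, Perm.mul_apply, hs.apply_apply, hfτ, hfx]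
  have hSsurj : Set.SurjOn (s * τ) S S :=
    ((Set.toFinite S).injOn_iff_bijOn_of_mapsTo hS).1 (s * τ).injective.injOn |>.surjOn
  obtain ⟨y, ⟨-, hfy⟩, hya⟩ := hSsurj (show a ∈ S from ⟨SameCycle.refl _ _, Iff.rfl⟩)
  rw [← hya, Perm.mul_apply, hs.apply_apply, hfτ, hfy, ← Perm.mul_apply, hya]

theorem JoinedOn.of_sameCycle [Finite F] {s s' τ : Perm F} (hs : IsPairing s) (hτ : IsPairing τ)
    (h : JoinedOn Set.univ s τ) {a b : F} (hab : SameCycle (s * τ) a b)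
    (ha : s' a = b) (hsa : s' (s a) = s b)
    (hoff : ∀ z, z ≠ a → z ≠ b → z ≠ s a → z ≠ s b → s' z = s z) :
    JoinedOn Set.univ s' τ := by
  intro f hf hfτ
  have hfb : f b ↔ f a := by rw [← ha, hf a trivial]
  have hfsa : f (s a) ↔ f a :=
    iff_of_sameCycle hs hτ hab ha hoff (fun x => hf x trivial) fun x => hfτ x trivial
  have hfsb : f (s b) ↔ f a := by rw [← hsa, hf (s a) trivial, hfsa]
  refine h f (fun x _ => ?_) hfτ
  by_cases hxa : x = a
  · rw [hxa, hfsa]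
  by_cases hxb : x = b
  · rw [hxb, hfsb, hfb]
  by_cases hxsa : x = s a
  · rw [hxsa, hs.apply_apply, hfsa]
  by_cases hxsb : x = s b
  · rw [hxsb, hs.apply_apply, hfsb, hfb]
  rw [← hoff x hxa hxb hxsa hxsb, hf x trivial]

end Pairings

section Smoothing

variable {F : Type*}

/-- The flags of the vertex of `a`, for a vertex permutation `σ` whose fourth power is trivial. -/
def vertex (σ : Perm F) (a : F) : Set F := {a, σ a, σ (σ a), σ (σ (σ a))}

theorem mem_vertex {σ : Perm F} {a x : F} :
    x ∈ vertex σ a ↔ x = a ∨ x = σ a ∨ x = σ (σ a) ∨ x = σ (σ (σ a)) := Iff.rfl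

/-- All cycles of `σ` have length two or four, and `s` maps each flag to the opposite flag of its
cycle. Cycles of length two occur as the two strands of a smoothed vertex. -/
structure IsOpposite (σ s : Perm F) : Prop where
  apply_ne : ∀ x, σ x ≠ x
  apply_four : ∀ x, σ (σ (σ (σ x))) = x
  eq_apply : ∀ x, σ (σ x) = x → s x = σ x
  eq_apply_apply : ∀ x, σ (σ x) ≠ x → s x = σ (σ x)

/-- The permutation obtained by splitting the cycle of `a` between `a` and `σ² a`. -/
def smooth [DecidableEq F] (σ : Perm F) (a : F) : Perm F := swap a (σ (σ a)) * σ

/-- The opposite-flag permutation that belongs to `smooth σ a`. -/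
def smoothOpp [DecidableEq F] (σ s : Perm F) (a : F) : Perm F :=
  swap (σ a) (σ (σ a)) * s * (swap (σ a) (σ (σ a)))⁻¹

theorem smooth_apply_apply [DecidableEq F] (σ : Perm F) (a : F) : smooth σ a (σ a) = a :=
  swap_apply_right _ _

theorem numCycles_le_numCycles_smooth_mul_add_one [Finite F] [DecidableEq F] (σ τ : Perm F)
    (a : F) : numCycles (σ * τ) ≤ numCycles (smooth σ a * τ) + 1 := by
  rw [smooth, mul_assoc]
  exact numCycles_le_numCycles_swap_mul_add_one _ _ _

namespace IsOpposite

variable {σ s : Perm F} {a : F}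

theorem isPairing (h : IsOpposite σ s) : IsPairing s := by
  obtain ⟨hne, hfour, htwo, hopp⟩ := h
  refine ⟨fun x => ?_, fun x => ?_⟩ <;> by_cases hx : σ (σ x) = x <;> grind

theorem apply_apply_apply_ne (h : IsOpposite σ s) (x : F) : σ (σ (σ x)) ≠ x := fun hx =>
  h.apply_ne x ((congrArg σ hx).symm.trans (h.apply_four x))

theorem nodup (h : IsOpposite σ s) (ha : σ (σ a) ≠ a) :
    [a, σ a, σ (σ a), σ (σ (σ a))].Nodup := by
  simp [(h.apply_ne a).symm, ha.symm, (h.apply_apply_apply_ne a).symm]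

theorem apply_mem_vertex (h : IsOpposite σ s) {x : F} : σ x ∈ vertex σ a ↔ x ∈ vertex σ a := by
  have hpred : σ x = a ↔ x = σ (σ (σ a)) := by
    rw [← σ.injective.eq_iff (b := σ (σ (σ a))), h.apply_four]
  simp only [mem_vertex, hpred, σ.injective.eq_iff]
  tauto

theorem ncard_vertex (h : IsOpposite σ s) (ha : σ (σ a) ≠ a) : (vertex σ a).ncard = 4 := by
  classical
  have hlist : vertex σ a = ↑[a, σ a, σ (σ a), σ (σ (σ a))].toFinset := by
    ext x
    simp [mem_vertex]
  rw [hlist, Set.ncard_coe_finset, List.toFinset_card_of_nodup (h.nodup ha)]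
  rfl

section DecidableEq

variable [DecidableEq F]

theorem smooth_apply_self (h : IsOpposite σ s) : smooth σ a a = σ a :=
  swap_apply_of_ne_of_ne (h.apply_ne a) (h.apply_ne (σ a)).symm

theorem smooth_apply_apply_apply (h : IsOpposite σ s) :
    smooth σ a (σ (σ a)) = σ (σ (σ a)) :=
  swap_apply_of_ne_of_ne (h.apply_apply_apply_ne a) (h.apply_ne _)

theorem smooth_apply_apply_apply_apply (h : IsOpposite σ s) :
    smooth σ a (σ (σ (σ a))) = σ (σ a) := by
  rw [smooth, Perm.mul_apply, h.apply_four, swap_apply_left]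

theorem smooth_apply_of_notMem (h : IsOpposite σ s) {x : F} (hx : x ∉ vertex σ a) :
    smooth σ a x = σ x := by
  rw [← h.apply_mem_vertex, mem_vertex] at hx
  exact swap_apply_of_ne_of_ne (by tauto) (by tauto)

theorem smooth_smooth_apply_of_mem (h : IsOpposite σ s) {x : F} (hx : x ∈ vertex σ a) :
    smooth σ a (smooth σ a x) = x := by
  rcases hx with rfl | rfl | rfl | rfl <;>
    simp only [h.smooth_apply_self, smooth_apply_apply, h.smooth_apply_apply_apply,
      h.smooth_apply_apply_apply_apply]

theorem smooth_apply_ne_of_mem (h : IsOpposite σ s) {x : F} (hx : x ∈ vertex σ a) :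
    smooth σ a x ≠ x := by
  rcases hx with rfl | rfl | rfl | rfl
  · rw [h.smooth_apply_self]
    exact h.apply_ne x
  · rw [smooth_apply_apply]
    exact (h.apply_ne a).symm
  · rw [h.smooth_apply_apply_apply]
    exact h.apply_ne _
  · rw [h.smooth_apply_apply_apply_apply]
    exact (h.apply_ne _).symm

theorem smoothOpp_apply_of_mem (h : IsOpposite σ s) (ha : σ (σ a) ≠ a) {x : F}
    (hx : x ∈ vertex σ a) : smoothOpp σ s a x = smooth σ a x := by
  have hopp : ∀ z, σ (σ z) ≠ z → s z = σ (σ z) := h.eq_apply_apply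
  have hfour := h.apply_four a
  have hnodup := h.nodup ha
  rcases hx with rfl | rfl | rfl | rfl <;>
  simp only [h.smooth_apply_self, smooth_apply_apply, h.smooth_apply_apply_apply,
      h.smooth_apply_apply_apply_apply, smoothOpp, Perm.mul_apply, swap_inv, swap_apply_def] <;>
  clear h <;> grind

theorem smoothOpp_apply_of_notMem (h : IsOpposite σ s) {x : F} (hx : x ∉ vertex σ a) :
    smoothOpp σ s a x = s x := by
  have hsx : s x ∉ vertex σ a := by
    by_cases hxx : σ (σ x) = x
    · rwa [h.eq_apply x hxx, h.apply_mem_vertex]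
    · rwa [h.eq_apply_apply x hxx, h.apply_mem_vertex, h.apply_mem_vertex]
  rw [mem_vertex] at hx hsx
  have hswap : swap (σ a) (σ (σ a)) x = x := swap_apply_of_ne_of_ne (by tauto) (by tauto)
  rw [smoothOpp, Perm.mul_apply, Perm.mul_apply, swap_inv, hswap]
  exact swap_apply_of_ne_of_ne (by tauto) (by tauto)

theorem isOpposite_smooth (h : IsOpposite σ s) (ha : σ (σ a) ≠ a) :
    IsOpposite (smooth σ a) (smoothOpp σ s a) := by
  have hmem := fun x hx => h.smooth_smooth_apply_of_mem (a := a) (x := x) hx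
  have hsmooth := fun x hx => h.smooth_apply_of_notMem (a := a) (x := x) hx
  have hv : ∀ {x}, x ∉ vertex σ a → σ x ∉ vertex σ a := h.apply_mem_vertex.not.2
  refine ⟨fun x => ?_, fun x => ?_, fun x => ?_, fun x => ?_⟩ <;> by_cases hx : x ∈ vertex σ a
  · exact h.smooth_apply_ne_of_mem hx
  · rw [hsmooth x hx]
    exact h.apply_ne x
  · rw [hmem x hx, hmem x hx]
  · rw [hsmooth x hx, hsmooth _ (hv hx), hsmooth _ (hv (hv hx)), hsmooth _ (hv (hv (hv hx))),
      h.apply_four]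
  · exact fun _ => h.smoothOpp_apply_of_mem ha hx
  · rw [hsmooth x hx, hsmooth _ (hv hx), h.smoothOpp_apply_of_notMem hx]
    exact h.eq_apply x
  · exact fun hne => absurd (hmem x hx) hne
  · rw [hsmooth x hx, hsmooth _ (hv hx), h.smoothOpp_apply_of_notMem hx]
    exact h.eq_apply_apply x

theorem ncard_smooth [Finite F] (h : IsOpposite σ s) (ha : σ (σ a) ≠ a) :
    {x | smooth σ a (smooth σ a x) ≠ x}.ncard + 4 = {x | σ (σ x) ≠ x}.ncard := by
  have hsub : vertex σ a ⊆ {x | σ (σ x) ≠ x} := by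
    have hne := h.nodup ha
    have hfour := h.apply_four a
    have hfour' := h.apply_four (σ a)
    rintro x (rfl | rfl | rfl | rfl) <;> simp only [Set.mem_ofPred_eq] <;> clear h <;> grind
  have hdiff : {x | smooth σ a (smooth σ a x) ≠ x} = {x | σ (σ x) ≠ x} \ vertex σ a := by
    ext x
    rw [Set.mem_sdiff]
    by_cases hx : x ∈ vertex σ a
    · simp [hx, h.smooth_smooth_apply_of_mem hx]
    · simp [hx, h.smooth_apply_of_notMem hx, h.smooth_apply_of_notMem (h.apply_mem_vertex.not.2 hx)]
  rw [hdiff, ← h.ncard_vertex ha, Set.ncard_sdiff_add_ncard_of_subset hsub]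

theorem joinedOn_smooth [Finite F] (h : IsOpposite σ s) {τ : Perm F} (hτ : IsPairing τ)
    (hj : JoinedOn Set.univ s τ) (ha : σ (σ a) ≠ a) (hab : SameCycle (s * τ) a (σ a)) :
    JoinedOn Set.univ (smoothOpp σ s a) τ := by
  have hsa : s a = σ (σ a) := h.eq_apply_apply a ha
  have hsb : s (σ a) = σ (σ (σ a)) := h.eq_apply_apply _ (σ.injective.ne ha)
  refine hj.of_sameCycle h.isPairing hτ hab ?_ ?_ fun z hza hzb hzsa hzsb => ?_
  · rw [h.smoothOpp_apply_of_mem ha (by simp [mem_vertex]), h.smooth_apply_self]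
  · rw [hsa, hsb, h.smoothOpp_apply_of_mem ha (by simp [mem_vertex]), h.smooth_apply_apply_apply]
  · rw [hsa] at hzsa
    rw [hsb] at hzsb
    exact h.smoothOpp_apply_of_notMem (by simp [mem_vertex, *])

theorem joinedOn_smooth_or_joinedOn_smooth [Finite F] (h : IsOpposite σ s) {τ : Perm F}
    (hτ : IsPairing τ) (hj : JoinedOn Set.univ s τ) (ha : σ (σ a) ≠ a) :
    JoinedOn Set.univ (smoothOpp σ s a) τ ∨ JoinedOn Set.univ (smoothOpp σ s (σ a)) τ := by
  have hs := h.isPairing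
  rcases hj.sameCycle_or_sameCycle_apply hs hτ a (σ a) with hab | hab
  · exact Or.inl (h.joinedOn_smooth hτ hj ha hab)
  · refine Or.inr (h.joinedOn_smooth hτ hj (σ.injective.ne ha) ?_)
    rw [← h.eq_apply_apply a ha, hτ.sameCycle_apply_left_iff]
    exact hab.symm

end DecidableEq

/-- Euler's inequality: smoothing the `m` crossings of a single curve one at a time leaves a
circle, which has two faces, and each smoothing destroys at most one face. -/
theorem numCycles_mul_le [Finite F] [Nonempty F] {τ : Perm F} (hτ : IsPairing τ) {m : ℕ} :
    ∀ {σ s : Perm F}, IsOpposite σ s → JoinedOn Set.univ s τ → {x | σ (σ x) ≠ x}.ncard = 4 * m →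
      numCycles (σ * τ) ≤ m + 2 := by
  classical
  induction m with
  | zero =>
    intro σ s h hj hm
    rw [mul_zero, Set.ncard_eq_zero, Set.eq_empty_iff_forall_notMem] at hm
    have hσs : σ = s := Perm.ext fun x => (h.eq_apply x (not_not.1 (hm x))).symm
    rw [hσs, (joinedOn_univ_iff_numCycles_eq_two h.isPairing hτ).1 hj]
  | succ m ih =>
    intro σ s h hj hm
    obtain ⟨a, ha, hja⟩ : ∃ a, σ (σ a) ≠ a ∧ JoinedOn Set.univ (smoothOpp σ s a) τ := by
      obtain ⟨a, ha⟩ : {x | σ (σ x) ≠ x}.Nonempty := (Set.ncard_pos).1 (by omega)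
      rcases h.joinedOn_smooth_or_joinedOn_smooth hτ hj ha with hja | hja
      · exact ⟨a, ha, hja⟩
      · exact ⟨σ a, σ.injective.ne ha, hja⟩
    have hsmooth := ih (h.isOpposite_smooth ha) hja (by have := h.ncard_smooth ha; omega)
    exact (numCycles_le_numCycles_smooth_mul_add_one σ τ a).trans (Nat.succ_le_succ hsmooth)

end IsOpposite

end Smoothing

section Reconnect

variable {F : Type*} [DecidableEq F]

/-- Replaces the edges of `p` and `q` by an edge that joins `p` and `q` and an edge that joins
their former partners. -/
def reconnect (τ : Perm F) (p q : F) : Perm F :=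
  swap q (τ p) * τ * (swap q (τ p))⁻¹

variable {s σ τ : Perm F} {p q : F}

namespace IsPairing

theorem isPairing_reconnect (h : IsPairing τ) (p q : F) : IsPairing (reconnect τ p q) :=
  h.conj _

theorem reconnect_apply_left (h : IsPairing τ) (hpq : p ≠ q) :
    reconnect τ p q p = q := by
  simp [reconnect, swap_apply_of_ne_of_ne hpq (h.apply_ne p).symm]

theorem reconnect_apply_right (h : IsPairing τ) (hpq : p ≠ q) :
    reconnect τ p q q = p := by
  simp [reconnect, h.apply_apply, swap_apply_of_ne_of_ne hpq (h.apply_ne p).symm]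

theorem reconnect_apply_apply_left (h : IsPairing τ) (hpq : p ≠ q) :
    reconnect τ p q (τ p) = τ q := by
  simp [reconnect, swap_apply_of_ne_of_ne (h.apply_ne q) (τ.injective.ne hpq.symm)]

theorem reconnect_apply_apply_right (h : IsPairing τ) (hpq : p ≠ q) :
    reconnect τ p q (τ q) = τ p := by
  simp [reconnect, h.apply_apply,
    swap_apply_of_ne_of_ne (h.apply_ne q) (τ.injective.ne hpq.symm)]

theorem reconnect_apply_of_ne (h : IsPairing τ) {z : F} (hzp : z ≠ p) (hzq : z ≠ q)
    (hτzp : τ z ≠ p) (hτzq : τ z ≠ q) : reconnect τ p q z = τ z := by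
  have hz : z ≠ τ p := fun e => hτzp (h.apply_eq_iff.2 e)
  rw [reconnect, Perm.mul_apply, Perm.mul_apply, swap_inv,
    swap_apply_of_ne_of_ne hzq hz, swap_apply_of_ne_of_ne hτzq (τ.injective.ne hzp)]

theorem mul_reconnect (h : IsPairing τ) (σ : Perm F) (p q : F) :
    σ * reconnect τ p q =
      swap (σ q) (σ (τ p)) * (swap (σ (τ q)) (σ p) * (σ * τ)) := by
  rw [reconnect, swap_inv, ← mul_assoc, ← mul_assoc, mul_swap_eq_swap_mul σ, mul_assoc, mul_assoc,
    mul_swap_eq_swap_mul τ, ← mul_assoc σ, mul_swap_eq_swap_mul σ, h.apply_apply, mul_assoc]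

end IsPairing

theorem numCycles_le_numCycles_mul_reconnect [Finite F] (h : IsPairing τ) (σ : Perm F) (p q : F) :
    numCycles (σ * τ) ≤ numCycles (σ * reconnect τ p q) + 2 := by
  rw [h.mul_reconnect]
  have hp := numCycles_le_numCycles_swap_mul_add_one (σ * τ) (σ (τ q)) (σ p)
  have hq := numCycles_le_numCycles_swap_mul_add_one (swap (σ (τ q)) (σ p) * (σ * τ)) (σ q)
    (σ (τ p))
  omega

theorem numCycles_mul_add_two_le [Finite F] (h : IsPairing τ) (hp : σ p = q) (hq : σ q = p)
    (hpq : p ≠ q) (hne : τ p ≠ q) :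
    numCycles (σ * τ) + 2 ≤ numCycles (σ * reconnect τ p q) := by
  have hτq : (σ * τ) q ≠ q := fun e =>
    hne (h.apply_eq_iff.2 (σ.injective (hp.trans e.symm)))
  have hτp : (swap q (σ (τ q)) * (σ * τ)) p = σ (τ p) := by
    refine swap_apply_of_ne_of_ne (fun e => ?_) fun e => ?_
    · exact h.apply_ne p (σ.injective (e.trans hp.symm))
    · exact hpq (τ.injective (σ.injective e))
  have hsplit := numCycles_add_one_le_numCycles_swap_apply_mul hτq
  have hsplit' := numCycles_add_one_le_numCycles_swap_apply_mul
    (φ := swap q (σ (τ q)) * (σ * τ)) (p := p)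
    (by rw [hτp]; exact fun e => hne (σ.injective (e.trans hq.symm)))
  rw [hτp] at hsplit'
  rw [h.mul_reconnect, hp, hq, swap_comm (σ (τ q))]
  exact (Nat.succ_le_succ hsplit).trans hsplit'

theorem JoinedOn.joinedOn_reconnect (h : IsPairing τ) {A : Set F} (hj : JoinedOn A s τ)
    (hτp : τ p ∈ A) (hp : p ∈ A) (hsp : s p = q) (hsq : s q = p) (hpq : p ≠ q)
    (hne : τ p ≠ q) : JoinedOn (A \ {p, q}) s (reconnect τ p q) := by
  have hne' : τ q ≠ p := fun e => hne (h.apply_eq_iff.2 e.symm)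
  refine hj.sdiff h.apply_apply (r := fun _ => τ p) (fun z _ => ⟨hτp, ?_⟩) (fun z => ?_)
    (fun _ _ => rfl) (fun z hz => Or.inr ?_) fun z hz hτz => ?_
  · simp [h.apply_ne, hne]
  · have hzp : s z = p ↔ z = q := by rw [← hsq, s.injective.eq_iff]
    have hzq : s z = q ↔ z = p := by rw [← hsp, s.injective.eq_iff]
    rw [Set.mem_insert_iff, Set.mem_singleton_iff, hzp, hzq, or_comm]
    rfl
  · rw [h.reconnect_apply_apply_left hpq]
    rcases hz with rfl | rfl <;> simp [h.apply_ne, hne, hne']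
  · simp only [Set.mem_sdiff, Set.mem_insert_iff, Set.mem_singleton_iff, not_or] at hz hτz
    exact h.reconnect_apply_of_ne hz.2.1 hz.2.2 hτz.1 hτz.2

end Reconnect

section Surgery

variable {F : Type*}

/-- All cycles of `σ` have length four. -/
structure IsQuartic (σ : Perm F) : Prop where
  apply_apply_ne : ∀ x, σ (σ x) ≠ x
  apply_four : ∀ x, σ (σ (σ (σ x))) = x

theorem isQuartic_iff_minimalPeriod {σ : Perm F} :
    IsQuartic σ ↔ ∀ x, Function.minimalPeriod σ x = 4 := by
  refine ⟨fun h x => ?_, fun h => ⟨fun x hx => ?_, fun x => ?_⟩⟩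
  · exact Function.minimalPeriod_eq_prime_pow (p := 2) (k := 1) (fun hx => h.apply_apply_ne x hx)
      (h.apply_four x)
  · have hdvd := (show Function.IsPeriodicPt σ 2 x from hx).minimalPeriod_dvd
    rw [h x] at hdvd
    omega
  · have hper := Function.isPeriodicPt_minimalPeriod σ x
    rwa [h x] at hper

theorem IsQuartic.isOpposite {σ : Perm F} (h : IsQuartic σ) : IsOpposite σ (σ * σ) where
  apply_ne x hx := h.apply_apply_ne x (by rw [hx, hx])
  apply_four := h.apply_four
  eq_apply x hx := absurd hx (h.apply_apply_ne x)
  eq_apply_apply _ _ := rfl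

theorem IsQuartic.apply_mem_vertex {σ : Perm F} (h : IsQuartic σ) {a x : F} :
    σ x ∈ vertex σ a ↔ x ∈ vertex σ a :=
  h.isOpposite.apply_mem_vertex

/-- The vertex of `a` carries a component of its own, a figure eight whose two loops leave `a`
and `σ² a` and return at `σ a` and `σ³ a`. -/
structure Floats (σ τ : Perm F) (a : F) : Prop where
  apply_self : τ a = σ a
  apply_opp : τ (σ (σ a)) = σ (σ (σ a))

namespace Floats

variable {σ τ : Perm F} {a : F}

theorem apply_apply_self (hτ : IsPairing τ) (h : Floats σ τ a) : τ (σ a) = a := by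
  rw [← h.apply_self, hτ.apply_apply]

theorem apply_apply_opp (hτ : IsPairing τ) (h : Floats σ τ a) : τ (σ (σ (σ a))) = σ (σ a) := by
  rw [← h.apply_opp, hτ.apply_apply]

theorem apply_mem_vertex (hτ : IsPairing τ) (h : Floats σ τ a) {x : F} :
    τ x ∈ vertex σ a ↔ x ∈ vertex σ a := by
  have hmaps : ∀ y ∈ vertex σ a, τ y ∈ vertex σ a := by
    rintro y (rfl | rfl | rfl | rfl)
    · simp [h.apply_self, mem_vertex]
    · simp [h.apply_apply_self hτ, mem_vertex]
    · simp [h.apply_opp, mem_vertex]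
    · simp [h.apply_apply_opp hτ, mem_vertex]
  exact ⟨fun hx => by simpa only [hτ.apply_apply] using hmaps _ hx, hmaps x⟩

end Floats

variable [DecidableEq F]

/-- Smooths the vertex of `a` and lets its flags float. -/
def extract (σ τ : Perm F) (a : F) : Perm F :=
  reconnect (reconnect τ a (σ a)) (σ (σ a)) (σ (σ (σ a)))

section Extract

variable {σ τ : Perm F} {a : F}

theorem IsPairing.isPairing_extract (hτ : IsPairing τ) (σ : Perm F) (a : F) :
    IsPairing (extract σ τ a) :=
  (hτ.isPairing_reconnect _ _).isPairing_reconnect _ _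

theorem floats_extract (hσ : IsQuartic σ) (hτ : IsPairing τ) (a : F) :
    Floats σ (extract σ τ a) a := by
  have hτ' := hτ.isPairing_reconnect a (σ a)
  have hne := hσ.isOpposite.nodup (hσ.apply_apply_ne a)
  simp only [List.nodup_cons, List.mem_cons, List.not_mem_nil, or_false, not_or] at hne
  obtain ⟨⟨h01, h02, h03⟩, ⟨h12, h13⟩, h23, -⟩ := hne
  refine ⟨?_, hτ'.reconnect_apply_left h23⟩
  have ha := hτ.reconnect_apply_left h01
  rw [extract, hτ'.reconnect_apply_of_ne h02 h03, ha] <;> rwa [ha]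

theorem extract_apply_of_notMem (hτ : IsPairing τ) {z : F} (hz : z ∉ vertex σ a)
    (hτz : τ z ∉ vertex σ a) : extract σ τ a z = τ z := by
  simp only [mem_vertex, not_or] at hz hτz
  have hz' : reconnect τ a (σ a) z = τ z :=
    hτ.reconnect_apply_of_ne hz.1 hz.2.1 hτz.1 hτz.2.1
  rw [extract, (hτ.isPairing_reconnect _ _).reconnect_apply_of_ne hz.2.2.1 hz.2.2.2 ?_ ?_, hz'] <;>
    rw [hz']
  exacts [hτz.2.2.1, hτz.2.2.2]

theorem extract_apply_apply_of_mem (hσ : IsQuartic σ) (hτ : IsPairing τ)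
    (hloop : ∀ x ∈ vertex σ a, τ x ∉ vertex σ a) {x : F} (hx : x ∈ vertex σ a) :
    extract σ τ a (τ x) = τ (smooth σ a x) := by
  have hopp := hσ.isOpposite
  have hτ' := hτ.isPairing_reconnect a (σ a)
  have hne := hopp.nodup (hσ.apply_apply_ne a)
  simp only [List.nodup_cons, List.mem_cons, List.not_mem_nil, or_false, not_or] at hne
  obtain ⟨⟨h01, h02, h03⟩, ⟨h12, h13⟩, h23, -⟩ := hne
  simp only [mem_vertex, not_or, forall_eq_or_imp, forall_eq] at hloop
  obtain ⟨l0, l1, l2, l3⟩ := hloop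
  have hfirst := hτ.reconnect_apply_apply_left h01
  have hfirst' := hτ.reconnect_apply_apply_right h01
  have hsecond : reconnect τ a (σ a) (σ (σ a)) = τ (σ (σ a)) :=
    hτ.reconnect_apply_of_ne (Ne.symm h02) (Ne.symm h12) l2.1 l2.2.1
  have hsecond' : reconnect τ a (σ a) (σ (σ (σ a))) = τ (σ (σ (σ a))) :=
    hτ.reconnect_apply_of_ne (Ne.symm h03) (Ne.symm h13) l3.1 l3.2.1
  rcases hx with rfl | rfl | rfl | rfl
  · rw [hopp.smooth_apply_self, extract, hτ'.reconnect_apply_of_ne l0.2.2.1 l0.2.2.2] <;>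
      rw [hfirst]
    exacts [l1.2.2.1, l1.2.2.2]
  · rw [smooth_apply_apply, extract, hτ'.reconnect_apply_of_ne l1.2.2.1 l1.2.2.2] <;> rw [hfirst']
    exacts [l0.2.2.1, l0.2.2.2]
  · rw [hopp.smooth_apply_apply_apply, extract, ← hsecond, hτ'.reconnect_apply_apply_left h23,
      hsecond']
  · rw [hopp.smooth_apply_apply_apply_apply, extract, ← hsecond',
      hτ'.reconnect_apply_apply_right h23, hsecond]

theorem reconnect_apply_opp_eq (hσ : IsQuartic σ) (hτ : IsPairing τ)
    (hopp : τ (σ (σ a)) ∉ vertex σ a) :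
    reconnect τ a (σ a) (σ (σ a)) = τ (σ (σ a)) := by
  simp only [mem_vertex, not_or] at hopp
  exact hτ.reconnect_apply_of_ne (hσ.apply_apply_ne a) (hσ.isOpposite.apply_ne _) hopp.1 hopp.2.1

theorem extract_apply_of_loop (hσ : IsQuartic σ) (hτ : IsPairing τ) (ha : τ a = σ (σ (σ a)))
    (hopp : reconnect τ a (σ a) (σ (σ a)) ≠ σ (σ (σ a))) :
    extract σ τ a (τ (σ a)) = τ (σ (σ a)) := by
  have hσa := hσ.isOpposite.apply_ne
  have hτ' := hτ.isPairing_reconnect a (σ a)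
  have hpartner := hτ.reconnect_apply_apply_right (hσa a).symm
  have hval : reconnect τ a (σ a) (σ (σ a)) = τ (σ (σ a)) := by
    refine hτ.reconnect_apply_of_ne (hσ.apply_apply_ne a) (hσa _) (fun h => ?_) fun h => hopp ?_
    · exact hσa (σ (σ a)) ((hτ.apply_eq_iff.1 h).trans ha).symm
    · rw [← hτ.apply_eq_iff.1 h] at hpartner
      exact hpartner.trans ha
  rw [← hval, ← hτ'.apply_apply (τ (σ a)), hpartner, ha]
  exact hτ'.reconnect_apply_apply_right (hσa _).symm

theorem numCycles_add_two_le_extract [Finite F] (hσ : IsQuartic σ) (hτ : IsPairing τ)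
    (ha : τ a ≠ σ a) (ha' : reconnect τ a (σ a) (σ (σ a)) ≠ σ (σ (σ a))) :
    numCycles (σ * τ) + 2 ≤ numCycles (σ * extract σ τ a) := by
  have hopp := hσ.isOpposite
  have hsmooth := numCycles_le_numCycles_smooth_mul_add_one σ τ a
  have hfirst := numCycles_mul_add_two_le hτ hopp.smooth_apply_self (smooth_apply_apply σ a)
    (hopp.apply_ne a).symm ha
  have hsecond := numCycles_mul_add_two_le (hτ.isPairing_reconnect a (σ a))
    hopp.smooth_apply_apply_apply hopp.smooth_apply_apply_apply_apply (hopp.apply_ne _).symm ha'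
  have hmerge := numCycles_le_numCycles_swap_mul_add_one (smooth σ a * extract σ τ a) a (σ (σ a))
  have hmul : swap a (σ (σ a)) * (smooth σ a * extract σ τ a) = σ * extract σ τ a := by
    rw [smooth, ← mul_assoc, ← mul_assoc, swap_mul_self, one_mul]
  rw [hmul] at hmerge
  rw [extract] at hmerge ⊢
  omega

theorem numCycles_add_two_le_extract_of_forall_notMem [Finite F] (hσ : IsQuartic σ)
    (hτ : IsPairing τ) (hloop : ∀ x ∈ vertex σ a, τ x ∉ vertex σ a) :
    numCycles (σ * τ) + 2 ≤ numCycles (σ * extract σ τ a) := by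
  simp only [mem_vertex, not_or, forall_eq_or_imp, forall_eq] at hloop
  refine numCycles_add_two_le_extract hσ hτ hloop.1.2.1 ?_
  rw [reconnect_apply_opp_eq hσ hτ (by simp only [mem_vertex]; tauto)]
  exact hloop.2.2.1.2.2.2

end Extract

section JoinedSmoothing

variable {σ τ : Perm F} {a : F} (hσ : IsQuartic σ) (hτ : IsPairing τ)
  (hj : JoinedOn Set.univ (smoothOpp σ (σ * σ) a) τ) (hV : vertex σ a ≠ Set.univ)

include hσ hτ hj hV

theorem apply_ne_of_joinedOn_smoothOpp : τ a ≠ σ a := by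
  have hopp := hσ.isOpposite
  have hs := fun x hx => hopp.smoothOpp_apply_of_mem (hσ.apply_apply_ne a) (x := x) hx
  refine hj.apply_ne hτ trivial ?_ ?_ fun hsub => ?_
  · rw [hs _ (by simp [mem_vertex]), hopp.smooth_apply_self]
  · rw [hs _ (by simp [mem_vertex]), smooth_apply_apply]
  · exact hV (Set.univ_subset_iff.1 (hsub.trans (by simp [Set.subset_def, mem_vertex])))

theorem joinedOn_smoothOpp_reconnect :
    JoinedOn {a, σ a}ᶜ (smoothOpp σ (σ * σ) a) (reconnect τ a (σ a)) := by
  have hopp := hσ.isOpposite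
  have hs := fun x hx => hopp.smoothOpp_apply_of_mem (hσ.apply_apply_ne a) (x := x) hx
  rw [Set.compl_eq_univ_sdiff]
  refine hj.joinedOn_reconnect hτ trivial trivial ?_ ?_ (hopp.apply_ne a).symm
    (apply_ne_of_joinedOn_smoothOpp hσ hτ hj hV)
  · rw [hs _ (by simp [mem_vertex]), hopp.smooth_apply_self]
  · rw [hs _ (by simp [mem_vertex]), smooth_apply_apply]

theorem reconnect_apply_ne_of_joinedOn_smoothOpp :
    reconnect τ a (σ a) (σ (σ a)) ≠ σ (σ (σ a)) := by
  have hopp := hσ.isOpposite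
  have hs := fun x hx => hopp.smoothOpp_apply_of_mem (hσ.apply_apply_ne a) (x := x) hx
  refine (joinedOn_smoothOpp_reconnect hσ hτ hj hV).apply_ne (hτ.isPairing_reconnect _ _) ?_ ?_ ?_
    fun hsub => hV (Set.eq_univ_of_forall fun x => ?_)
  · simp [hσ.apply_apply_ne, hopp.apply_ne]
  · rw [hs _ (by simp [mem_vertex]), hopp.smooth_apply_apply_apply]
  · rw [hs _ (by simp [mem_vertex]), hopp.smooth_apply_apply_apply_apply]
  · by_cases hx : x ∈ ({a, σ a} : Set F)
    · exact hx.elim Or.inl fun hx => Or.inr (Or.inl hx)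
    · exact Or.inr (Or.inr (hsub hx))

theorem joinedOn_extract : JoinedOn (vertex σ a)ᶜ (σ * σ) (extract σ τ a) := by
  have hopp := hσ.isOpposite
  have hs := fun x hx => hopp.smoothOpp_apply_of_mem (hσ.apply_apply_ne a) (x := x) hx
  have hτ' := hτ.isPairing_reconnect a (σ a)
  have hset : (vertex σ a)ᶜ = {a, σ a}ᶜ \ {σ (σ a), σ (σ (σ a))} := by
    ext x
    simp [mem_vertex, and_assoc]
  have hjoin : JoinedOn (vertex σ a)ᶜ (smoothOpp σ (σ * σ) a) (extract σ τ a) := by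
    rw [hset]
    refine (joinedOn_smoothOpp_reconnect hσ hτ hj hV).joinedOn_reconnect hτ' ?_ ?_ ?_ ?_
      (hopp.apply_ne _).symm (reconnect_apply_ne_of_joinedOn_smoothOpp hσ hτ hj hV)
    · have hne := (hopp.apply_ne a).symm
      simp [hτ'.apply_eq_iff, hτ.reconnect_apply_left hne, hτ.reconnect_apply_right hne,
        hσ.apply_apply_ne, hopp.apply_ne]
    · simp [hσ.apply_apply_ne, hopp.apply_ne]
    · rw [hs _ (by simp [mem_vertex]), hopp.smooth_apply_apply_apply]
    · rw [hs _ (by simp [mem_vertex]), hopp.smooth_apply_apply_apply_apply]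
  exact hjoin.congr (fun x hx => (hopp.smoothOpp_apply_of_notMem hx).symm) fun _ _ => rfl

theorem numCycles_add_two_le_extract_of_joinedOn_smoothOpp [Finite F] :
    numCycles (σ * τ) + 2 ≤ numCycles (σ * extract σ τ a) :=
  numCycles_add_two_le_extract hσ hτ (apply_ne_of_joinedOn_smoothOpp hσ hτ hj hV)
    (reconnect_apply_ne_of_joinedOn_smoothOpp hσ hτ hj hV)

end JoinedSmoothing

/-- Attaches the floating vertex of `a` as a kink on the edge of `b`. -/
def kink (σ τ : Perm F) (a b : F) : Perm F :=
  reconnect (reconnect τ a (τ b)) (σ (σ a)) (σ a)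

theorem IsPairing.isPairing_kink {τ : Perm F} (hτ : IsPairing τ) (σ : Perm F) (a b : F) :
    IsPairing (kink σ τ a b) :=
  (hτ.isPairing_reconnect _ _).isPairing_reconnect _ _

section Kink

variable {σ τ : Perm F} {a b : F}

theorem kink_apply_opp (hσ : IsQuartic σ) (hτ : IsPairing τ) :
    kink σ τ a b (σ (σ a)) = σ a :=
  (hτ.isPairing_reconnect _ _).reconnect_apply_left (hσ.isOpposite.apply_ne _)

theorem kink_apply_of_ne (hτ : IsPairing τ) (hf : Floats σ τ a) {z : F} (hz : z ∉ vertex σ a)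
    (hzb : z ≠ b) (hzb' : z ≠ τ b) :
    kink σ τ a b z = τ z := by
  have hτz : τ z ∉ vertex σ a := mt (hf.apply_mem_vertex hτ).1 hz
  simp only [mem_vertex, not_or] at hz hτz
  have hfirst : reconnect τ a (τ b) z = τ z :=
    hτ.reconnect_apply_of_ne hz.1 hzb' hτz.1 (τ.injective.ne hzb)
  rw [kink, (hτ.isPairing_reconnect _ _).reconnect_apply_of_ne hz.2.2.1 hz.2.1, hfirst] <;>
    rw [hfirst]
  exacts [hτz.2.2.1, hτz.2.1]

theorem numCycles_le_numCycles_mul_kink_add_two [Finite F] (hσ : IsQuartic σ) (hτ : IsPairing τ)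
    (hf : Floats σ τ a) (b : F) :
    numCycles (σ * τ) ≤ numCycles (σ * kink σ τ a b) + 2 := by
  have hsplit := numCycles_add_one_le_numCycles_swap_apply_mul (φ := σ * τ) (p := a)
    (by rw [Perm.mul_apply, hf.apply_self]; exact hσ.apply_apply_ne a)
  rw [Perm.mul_apply, hf.apply_self, ← mul_assoc] at hsplit
  have hfirst := numCycles_le_numCycles_mul_reconnect hτ (smooth σ a) a (τ b)
  have hsecond := numCycles_le_numCycles_mul_reconnect (hτ.isPairing_reconnect a (τ b))
    (smooth σ a) (σ (σ a)) (σ a)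
  have happly : (smooth σ a * kink σ τ a b) (σ (σ a)) = a := by
    rw [Perm.mul_apply, kink_apply_opp hσ hτ, smooth_apply_apply]
  have hsplit' := numCycles_add_one_le_numCycles_swap_apply_mul
    (φ := smooth σ a * kink σ τ a b) (p := σ (σ a))
    (by rw [happly]; exact (hσ.apply_apply_ne a).symm)
  rw [happly, swap_comm, ← mul_assoc, smooth, ← mul_assoc, swap_mul_self, one_mul] at hsplit'
  rw [kink] at hsplit' ⊢
  rw [smooth] at hfirst hsecond
  omega

variable (hσ : IsQuartic σ) (hτ : IsPairing τ) (hf : Floats σ τ a) (hb : b ∉ vertex σ a)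

include hσ hτ hf hb

theorem kink_apply_self : kink σ τ a b a = τ b := by
  have hopp := hσ.isOpposite
  have hτb : τ b ∉ vertex σ a := mt (hf.apply_mem_vertex hτ).1 hb
  simp only [mem_vertex, not_or] at hτb
  have hfirst := hτ.reconnect_apply_left (Ne.symm hτb.1)
  rw [kink, (hτ.isPairing_reconnect _ _).reconnect_apply_of_ne (hσ.apply_apply_ne a).symm
    (hopp.apply_ne a).symm, hfirst] <;> rw [hfirst]
  exacts [hτb.2.2.1, hτb.2.1]

theorem kink_apply_apply_opp : kink σ τ a b (σ (σ (σ a))) = b := by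
  have hopp := hσ.isOpposite
  have hτb : τ b ∉ vertex σ a := mt (hf.apply_mem_vertex hτ).1 hb
  simp only [mem_vertex, not_or] at hb hτb
  have hleft : reconnect τ a (τ b) (σ (σ a)) = σ (σ (σ a)) := by
    rw [hτ.reconnect_apply_of_ne (hσ.apply_apply_ne a) (Ne.symm hτb.2.2.1), hf.apply_opp] <;>
      rw [hf.apply_opp]
    exacts [hopp.apply_apply_apply_ne a, Ne.symm hτb.2.2.2]
  have hright : reconnect τ a (τ b) (σ a) = b := by
    rw [← hf.apply_self, hτ.reconnect_apply_apply_left (Ne.symm hτb.1), hτ.apply_apply]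
  have hkink := (hτ.isPairing_reconnect a (τ b)).reconnect_apply_apply_left (hopp.apply_ne (σ a))
  rwa [hleft, hright] at hkink

theorem kink_apply_right : kink σ τ a b b = σ (σ (σ a)) := by
  rw [← (hτ.isPairing_kink σ a b).apply_eq_iff.2 (kink_apply_apply_opp hσ hτ hf hb).symm]

end Kink

theorem joinedOn_kink {σ τ : Perm F} {a b : F} {A : Set F} (hσ : IsQuartic σ) (hτ : IsPairing τ)
    (hf : Floats σ τ a) (hA : Disjoint A (vertex σ a)) (hb : b ∈ A) (hτb : τ b ∈ A)
    (hj : JoinedOn A (σ * σ) τ) : JoinedOn (A ∪ vertex σ a) (σ * σ) (kink σ τ a b) := by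
  rw [Set.disjoint_left] at hA
  have hbV := hA hb
  intro f hfs hfτ
  have hself := hfτ a (by simp [mem_vertex])
  have hopp := hfτ (σ (σ a)) (by simp [mem_vertex])
  have hopp' := hfτ (σ (σ (σ a))) (by simp [mem_vertex])
  have hstrand : f (σ (σ a)) ↔ f a := hfs a (by simp [mem_vertex])
  have hstrand' : f (σ (σ (σ a))) ↔ f (σ a) := hfs (σ a) (by simp [mem_vertex])
  rw [kink_apply_self hσ hτ hf hbV] at hself
  rw [kink_apply_opp hσ hτ] at hopp
  rw [kink_apply_apply_opp hσ hτ hf hbV] at hopp'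
  have hconst : ∀ x ∈ A, ∀ y ∈ A, f x → f y := by
    refine hj f (fun x hx => hfs x (Or.inl hx)) fun x hx => ?_
    by_cases hxb : x = b
    · subst hxb; tauto
    by_cases hxb' : x = τ b
    · subst hxb'; rw [hτ.apply_apply]; tauto
    rw [← kink_apply_of_ne hτ hf (hA hx) hxb hxb']
    exact hfτ x (Or.inl hx)
  have hall : ∀ x ∈ A ∪ vertex σ a, (f x ↔ f b) := by
    have hτb_iff : f (τ b) ↔ f b := ⟨hconst _ hτb b hb, hconst b hb _ hτb⟩
    rintro x (hx | rfl | rfl | rfl | rfl)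
    · exact ⟨hconst x hx b hb, hconst b hb x hx⟩
    all_goals tauto
  exact fun x hx y hy hfx => (hall y hy).2 ((hall x hx).1 hfx)

end Surgery

section Detach

variable {F : Type*}

/-- `τ'` keeps every edge of `τ` that does not meet `S`. -/
def AgreeOff (S : Set F) (τ τ' : Perm F) : Prop :=
  ∀ z ∉ S, τ z ∉ S → τ' z = τ z

theorem AgreeOff.mono {S T : Set F} {τ τ' : Perm F} (h : AgreeOff S τ τ') (hST : S ⊆ T) :
    AgreeOff T τ τ' :=
  fun z hz hτz => h z (fun hzS => hz (hST hzS)) fun hzS => hτz (hST hzS)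

theorem AgreeOff.eq_of_eqOn {S : Set F} {τ₁ τ₂ τ' : Perm F} (h₁ : IsPairing τ₁)
    (h₂ : IsPairing τ₂) (hoff₁ : AgreeOff S τ₁ τ') (hoff₂ : AgreeOff S τ₂ τ')
    (hS : Set.EqOn τ₁ τ₂ S) : τ₁ = τ₂ := by
  ext z
  by_cases hz : z ∈ S
  · exact hS hz
  by_cases hz₁ : τ₁ z ∈ S
  · rw [← h₂.apply_eq_iff, ← hS hz₁, h₁.apply_apply]
  by_cases hz₂ : τ₂ z ∈ S
  · rw [h₁.apply_eq_iff, hS hz₂, h₂.apply_apply]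
  rw [← hoff₁ z hz hz₁, hoff₂ z hz hz₂]

/-- How to recover `τ` from the pairing `τ'` in which the vertex of `a` floats, given a flag `m`
and a number: `0` if the vertex had a loop (its other strand was cut out of the edge of `m`), `1`
if it lay between two bigons (it was swapped with the vertex of `m`), and `i + 2` if it was
smoothed (its two strands were cut out of the edges of `m` and of the flag `i` steps further along
the face of `m`). -/
inductive Code (σ τ τ' : Perm F) (a : F) : F → ℕ → Prop
  | loop (m : F) (hself : τ a = σ (σ (σ a))) (happly : τ (σ a) = m) (hopp : τ (σ (σ a)) = τ' m)
      (hoff : AgreeOff (vertex σ a) τ τ') : Code σ τ τ' a m 0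
  | bigons (m : F) (hself : τ a = τ' m) (happly : τ (σ a) = m) (hopp : τ (σ (σ a)) = σ (σ (σ m)))
      (hopp' : τ (σ (σ (σ a))) = σ (τ' m)) (hnext : τ (σ m) = τ' (σ (σ (σ m))))
      (hnext' : τ (σ (σ m)) = τ' (σ (τ' m)))
      (hoff : AgreeOff (vertex σ a ∪ vertex σ m) τ τ') : Code σ τ τ' a m 1
  | corner (m : F) (i : ℕ) (hself : τ a = m) (happly : τ (σ a) = τ' m)
      (hopp : τ (σ (σ a)) = τ' ((σ * τ')^[i] (σ m)))
      (hopp' : τ (σ (σ (σ a))) = (σ * τ')^[i] (σ m))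
      (hoff : AgreeOff (vertex σ a) τ τ') : Code σ τ τ' a m (i + 2)

theorem Code.unique {σ τ₁ τ₂ τ' : Perm F} {a m : F} {i : ℕ} (h₁ : IsPairing τ₁)
    (h₂ : IsPairing τ₂) (c₁ : Code σ τ₁ τ' a m i) (c₂ : Code σ τ₂ τ' a m i) : τ₁ = τ₂ := by
  have partner {x y : F} (hx : τ₁ x = y) (hy : τ₂ x = y) : τ₁ y = τ₂ y :=
    (h₁.apply_eq_iff.1 hx).symm.trans (h₂.apply_eq_iff.1 hy)
  cases c₁ with
  | loop hself happly hopp hoff =>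
    cases c₂ with
    | loop hself₂ happly₂ hopp₂ hoff₂ =>
      refine hoff.eq_of_eqOn h₁ h₂ hoff₂ ?_
      rintro z (rfl | rfl | rfl | rfl)
      exacts [hself.trans hself₂.symm, happly.trans happly₂.symm, hopp.trans hopp₂.symm,
        partner hself hself₂]
  | bigons hself happly hopp hopp' hnext hnext' hoff =>
    cases c₂ with
    | bigons hself₂ happly₂ hopp₂ hopp₂' hnext₂ hnext₂' hoff₂ =>
      refine hoff.eq_of_eqOn h₁ h₂ hoff₂ ?_
      rintro z ((rfl | rfl | rfl | rfl) | (rfl | rfl | rfl | rfl))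
      exacts [hself.trans hself₂.symm, happly.trans happly₂.symm, hopp.trans hopp₂.symm,
        hopp'.trans hopp₂'.symm, partner happly happly₂, hnext.trans hnext₂.symm,
        hnext'.trans hnext₂'.symm, partner hopp hopp₂]
  | corner j hself happly hopp hopp' hoff =>
    cases c₂ with
    | corner _ hself₂ happly₂ hopp₂ hopp₂' hoff₂ =>
      refine hoff.eq_of_eqOn h₁ h₂ hoff₂ ?_
      rintro z (rfl | rfl | rfl | rfl)
      exacts [hself.trans hself₂.symm, happly.trans happly₂.symm, hopp.trans hopp₂.symm,
        hopp'.trans hopp₂'.symm]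

/-- `σ` and `τ` are the vertices and edges of a plane curve with `n` crossings. By
`IsCurve.numCycles_eq` there cannot be more than `n + 2` faces. -/
structure IsCurve (n : ℕ) (σ τ : Perm F) : Prop where
  quartic : IsQuartic σ
  pairing : IsPairing τ
  joined : JoinedOn Set.univ (σ * σ) τ
  le_faces : n + 2 ≤ numCycles (σ * τ)

/-- `τ'` forms a curve with `n - 1` crossings next to the floating vertex of `a`, which has three
faces of its own. -/
structure Detached (n : ℕ) (σ τ' : Perm F) (a : F) : Prop where
  pairing : IsPairing τ'
  floats : Floats σ τ' a
  joined : JoinedOn (vertex σ a)ᶜ (σ * σ) τ'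
  le_faces : n + 4 ≤ numCycles (σ * τ')

/-- The flags near `a` whose edges may change when the vertex of `a` is detached: those at the
vertex of `a` itself and at the other end of the edge opposite to `a`. -/
def detachRegion (σ τ : Perm F) (a : F) : Set F := vertex σ a ∪ vertex σ (τ (σ (σ a)))

/-- `τ'` arises from `τ` by detaching the vertex of `a` in a way that changes few edges and can be
undone with little information. -/
def DetachesTo (n : ℕ) (σ τ : Perm F) (a : F) (τ' : Perm F) : Prop :=
  ∃ m i, Detached n σ τ' a ∧ Code σ τ τ' a m i ∧ i < 13 ∧ AgreeOff (detachRegion σ τ a) τ τ'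

/-- The vertex of `a` can be detached. -/
def Detachable (n : ℕ) (σ τ : Perm F) (a : F) : Prop := ∃ τ', DetachesTo n σ τ a τ'

theorem exists_iterate_eq_of_skip {u : ℕ → F} {V : Set F} {g : F → F} {r : ℕ} (h0 : u 0 ∉ V)
    (hsep : ∀ t, u t ∈ V → u (t + 1) ∉ V)
    (hstep : ∀ t, u t ∉ V → u (t + 1) ∉ V → g (u t) = u (t + 1))
    (hskip : ∀ t, t + 2 ≤ r → u (t + 1) ∈ V → g (u t) = u (t + 2)) :
    ∀ t ≤ r, u t ∉ V → ∃ i ≤ t, g^[i] (u 0) = u t := by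
  intro t
  induction t using Nat.strong_induction_on with
  | _ t ih =>
  intro htr ht
  rcases t with _ | t
  · exact ⟨0, le_rfl, rfl⟩
  by_cases hV : u t ∈ V
  · obtain ⟨t, rfl⟩ : ∃ t', t = t' + 1 := Nat.exists_eq_succ_of_ne_zero (by rintro rfl; exact h0 hV)
    obtain ⟨i, hi, hiter⟩ := ih t (by omega) (by omega) fun ht' => hsep t ht' hV
    exact ⟨i + 1, by omega, by rw [Function.iterate_succ_apply', hiter, hskip t htr hV]⟩
  · obtain ⟨i, hi, hiter⟩ := ih t (by omega) (by omega) hV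
    exact ⟨i + 1, by omega, by rw [Function.iterate_succ_apply', hiter, hstep t hV ht]⟩

theorem IsQuartic.iterate_apply_eq {σ τ : Perm F} {a : F} {r : ℕ} (hσ : IsQuartic σ)
    (hτ : IsPairing τ) (hr : Function.minimalPeriod (σ * τ) a = r + 2) :
    (σ * τ)^[r] ((σ * τ) a) = τ (σ (σ (σ a))) := by
  have hper : (σ * τ)^[r + 2] a = a := hr ▸ Function.iterate_minimalPeriod
  rw [Function.iterate_succ_apply, Function.iterate_succ_apply'] at hper
  rw [← hτ.apply_eq_iff]
  exact σ.injective (hper.trans (hσ.apply_four a).symm)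

theorem two_le_minimalPeriod_mul [Finite F] {σ τ : Perm F} {a : F} (hmono : σ (τ a) ≠ a) :
    2 ≤ Function.minimalPeriod (σ * τ) a :=
  Nat.two_le_iff _ |>.2 ⟨(minimalPeriod_pos _ a).ne', fun h =>
    hmono (Function.minimalPeriod_eq_one_iff_isFixedPt.1 h)⟩

namespace IsCurve

variable {n : ℕ} {σ τ : Perm F} {a : F}

theorem apply_ne_opp (h : IsCurve n σ τ) (a : F) : τ a ≠ σ (σ a) := by
  have hopp := h.quartic.isOpposite
  refine h.joined.apply_ne h.pairing trivial rfl (h.quartic.apply_four a) fun hsub => ?_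
  rcases hsub (Set.mem_univ (σ a)) with hσa | hσa
  exacts [hopp.apply_ne a hσa, hopp.apply_ne (σ a) (Set.mem_singleton_iff.1 hσa).symm]

variable [Finite F]

theorem numCycles_eq [Nonempty F] (h : IsCurve n σ τ) (hn : Nat.card F = 4 * n) :
    numCycles (σ * τ) = n + 2 := by
  classical
  refine le_antisymm
    (IsOpposite.numCycles_mul_le h.pairing h.quartic.isOpposite h.joined ?_) h.le_faces
  simp [h.quartic.apply_apply_ne, Set.ncard_univ, hn]

section DecidableEq

variable [DecidableEq F]

theorem detached_extract (h : IsCurve n σ τ) (hV : vertex σ a ≠ Set.univ)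
    (hc : JoinedOn Set.univ (smoothOpp σ (σ * σ) a) τ) : Detached n σ (extract σ τ a) a where
  pairing := h.pairing.isPairing_extract σ a
  floats := floats_extract h.quartic h.pairing a
  joined := joinedOn_extract h.quartic h.pairing hc hV
  le_faces := (Nat.add_le_add_right h.le_faces 2).trans
    (numCycles_add_two_le_extract_of_joinedOn_smoothOpp h.quartic h.pairing hc hV)

theorem numCycles_smooth_le (h : IsCurve n σ τ) (hn : Nat.card F = 4 * n)
    (hc : JoinedOn Set.univ (smoothOpp σ (σ * σ) a) τ) : numCycles (smooth σ a * τ) ≤ n + 1 := by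
  have hopp := h.quartic.isOpposite
  have ha := h.quartic.apply_apply_ne a
  have : Nonempty F := ⟨a⟩
  have hpos : 0 < Nat.card F := Nat.card_pos
  have hcard := hopp.ncard_smooth ha
  have huniv : {x | σ (σ x) ≠ x} = Set.univ := Set.eq_univ_of_forall h.quartic.apply_apply_ne
  rw [huniv, Set.ncard_univ, hn] at hcard
  have hle := IsOpposite.numCycles_mul_le h.pairing (m := n - 1) (hopp.isOpposite_smooth ha) hc
    (by omega)
  omega

theorem not_sameCycle_opp (h : IsCurve n σ τ) (hn : Nat.card F = 4 * n)
    (hc : JoinedOn Set.univ (smoothOpp σ (σ * σ) a) τ) : ¬ SameCycle (σ * τ) a (σ (σ a)) := by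
  intro hsame
  have hswap := numCycles_le_numCycles_swap_mul hsame
  have hsmooth := h.numCycles_smooth_le hn hc
  have hfaces := h.le_faces
  rw [← mul_assoc] at hswap
  rw [smooth] at hsmooth
  omega

theorem exists_iterate_extract (h : IsCurve n σ τ) (hn : Nat.card F = 4 * n)
    (hc : JoinedOn Set.univ (smoothOpp σ (σ * σ) a) τ)
    (hloop : ∀ x ∈ vertex σ a, τ x ∉ vertex σ a) :
    ∃ i, i + 2 ≤ Function.minimalPeriod (σ * τ) a ∧
      (σ * extract σ τ a)^[i] (σ (τ a)) = τ (σ (σ (σ a))) := by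
  have hσ := h.quartic
  have hτ := h.pairing
  have hmem : ∀ {x}, σ x ∈ vertex σ a ↔ x ∈ vertex σ a := hσ.apply_mem_vertex
  set φ := σ * τ with hφ
  have hφa : φ a ∉ vertex σ a := fun ha => hloop a (by simp [mem_vertex]) (hmem.1 ha)
  obtain ⟨r, hr⟩ : ∃ r, Function.minimalPeriod φ a = r + 2 :=
    Nat.exists_eq_add_of_le' (two_le_minimalPeriod_mul fun hfix =>
      hφa (by rw [hφ, Perm.mul_apply, hfix]; simp [mem_vertex]))
  have hne : ∀ t ≤ r, φ^[t] (φ a) ≠ a := fun t ht =>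
    Function.not_isPeriodicPt_of_pos_of_lt_minimalPeriod t.succ_ne_zero (by omega)
  have hne_opp : ∀ t, φ^[t] (φ a) ≠ σ (σ a) := fun t ht =>
    h.not_sameCycle_opp hn hc ⟨(t + 1 : ℕ), by
      rw [zpow_natCast, ← Equiv.Perm.iterate_eq_pow, Function.iterate_succ_apply, ht]⟩
  have hlast := hσ.iterate_apply_eq hτ hr
  have hskip : ∀ y, ∀ w ∈ vertex σ a, smooth σ a w = σ w → φ y = σ w →
      (σ * extract σ τ a) y = φ (φ y) := fun y w hw hsm hy => by
    have hyw : y = τ w := hτ.apply_eq_iff.1 (σ.injective hy)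
    rw [hy, Perm.mul_apply, hyw, extract_apply_apply_of_mem hσ hτ hloop hw, hsm, hφ, Perm.mul_apply]
  suffices hwalk : ∃ i ≤ r, (σ * extract σ τ a)^[i] (φ a) = φ^[r] (φ a) by
    obtain ⟨i, hi, hiter⟩ := hwalk
    exact ⟨i, by omega, hiter.trans hlast⟩
  refine exists_iterate_eq_of_skip (u := fun t => φ^[t] (φ a)) (V := vertex σ a) hφa
    (fun t ht => ?_) (fun t ht ht' => ?_) (fun t ht ht' => ?_) r le_rfl
    (hlast ▸ hloop _ (by simp [mem_vertex]))
  · simp only [Function.iterate_succ_apply'] at ht ⊢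
    exact fun ht' => hloop _ ht (hmem.1 ht')
  · simp only [Function.iterate_succ_apply'] at ht' ⊢
    rw [Perm.mul_apply, extract_apply_of_notMem hτ ht fun hτt => ht' (hmem.2 hτt)]
    rfl
  · rcases ht' with ht' | ht' | ht' | ht'
    · exact absurd ht' (hne _ (by omega))
    · simp only [Function.iterate_succ_apply'] at ht' ⊢
      exact hskip _ a (by simp [mem_vertex]) hσ.isOpposite.smooth_apply_self ht'
    · exact absurd ht' (hne_opp _)
    · simp only [Function.iterate_succ_apply'] at ht' ⊢
      exact hskip _ _ (by simp [mem_vertex]) hσ.isOpposite.smooth_apply_apply_apply ht'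

theorem detachable_of_corner (h : IsCurve n σ τ) (hn : Nat.card F = 4 * n)
    (hV : vertex σ a ≠ Set.univ) (hc : JoinedOn Set.univ (smoothOpp σ (σ * σ) a) τ)
    (hloop : ∀ x ∈ vertex σ a, τ x ∉ vertex σ a)
    (hd : Function.minimalPeriod (σ * τ) a ≤ 12) : Detachable n σ τ a := by
  have hσ := h.quartic
  have hτ := h.pairing
  have hopp := hσ.isOpposite
  obtain ⟨i, hi, hiter⟩ := h.exists_iterate_extract hn hc hloop
  have hself := extract_apply_apply_of_mem hσ hτ hloop (x := a) (by simp [mem_vertex])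
  have hopp' := extract_apply_apply_of_mem hσ hτ hloop (x := σ (σ (σ a))) (by simp [mem_vertex])
  rw [hopp.smooth_apply_self] at hself
  rw [hopp.smooth_apply_apply_apply_apply] at hopp'
  have hoff : AgreeOff (vertex σ a) τ (extract σ τ a) :=
    fun _ hz hτz => extract_apply_of_notMem hτ hz hτz
  exact ⟨_, _, i + 2, h.detached_extract hV hc,
    Code.corner _ _ rfl hself.symm (by rw [hiter, hopp']) hiter.symm hoff, by omega,
    hoff.mono Set.subset_union_left⟩

end DecidableEq

theorem detachable_of_loop (h : IsCurve n σ τ) (hV : vertex σ a ≠ Set.univ)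
    (ha : σ (τ a) = a) : Detachable n σ τ a := by
  classical
  have hσ := h.quartic
  have hτ := h.pairing
  have hloop : τ a = σ (σ (σ a)) := σ.injective (by rw [ha, hσ.apply_four])
  have hc : JoinedOn Set.univ (smoothOpp σ (σ * σ) a) τ := by
    refine hσ.isOpposite.joinedOn_smooth hτ h.joined (hσ.apply_apply_ne a) ⟨1, ?_⟩
    simp [ha]
  have hopp := extract_apply_of_loop hσ hτ hloop
    (reconnect_apply_ne_of_joinedOn_smoothOpp hσ hτ hc hV)
  have hoff : AgreeOff (vertex σ a) τ (extract σ τ a) :=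
    fun _ hz hτz => extract_apply_of_notMem hτ hz hτz
  exact ⟨_, _, _, h.detached_extract hV hc, Code.loop _ hloop rfl hopp.symm hoff, by norm_num,
    hoff.mono Set.subset_union_left⟩

end IsCurve

end Detach

section Bigons

variable {F : Type*} {n : ℕ} {σ τ : Perm F} {a u w : F}

theorem JoinedOn.eq_univ {s τ : F → F} {S : Set F} (hj : JoinedOn Set.univ s τ)
    (hs : ∀ x, s x ∈ S ↔ x ∈ S) (hτ : ∀ x, τ x ∈ S ↔ x ∈ S) (ha : a ∈ S) : S = Set.univ :=
  Set.eq_univ_of_forall fun x =>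
    hj (· ∈ S) (fun x _ => hs x) (fun x _ => hτ x) a trivial x trivial ha

theorem IsCurve.eq_univ {S : Set F} (h : IsCurve n σ τ) (hσS : ∀ x, σ x ∈ S ↔ x ∈ S)
    (hτS : ∀ x ∈ S, τ x ∈ S) (ha : a ∈ S) : S = Set.univ :=
  h.joined.eq_univ (fun x => (hσS (σ x)).trans (hσS x))
    (fun x => ⟨fun hx => h.pairing.apply_apply x ▸ hτS _ hx, hτS x⟩) ha

theorem IsQuartic.vertex_apply (h : IsQuartic σ) (a : F) : vertex σ (σ a) = vertex σ a := by
  ext x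
  simp only [mem_vertex, h.apply_four]
  tauto

theorem IsQuartic.nodup (h : IsQuartic σ) (a : F) : [a, σ a, σ (σ a), σ (σ (σ a))].Nodup :=
  h.isOpposite.nodup (h.apply_apply_ne a)

theorem IsQuartic.apply_eq_of_bigon (h : IsQuartic σ) (ha : σ (τ (σ (τ a))) = a) :
    τ (σ (τ a)) = σ (σ (σ a)) :=
  σ.injective (by rw [ha, h.apply_four])

/-- The face on one side of `a` is a bigon shared with the vertex of `u`, and the face on the other
side of `σ² a` is a bigon shared with the vertex of `w`, which is different from the vertices of
`a` and `u` and has no loop. -/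
structure BigonChain (σ τ : Perm F) (a u w : F) : Prop where
  apply_self : τ a = u
  apply_apply_fst : τ (σ u) = σ (σ (σ a))
  apply_opp : τ (σ (σ a)) = w
  apply_apply_snd : τ (σ w) = σ a
  fst_notMem : u ∉ vertex σ a
  snd_notMem : w ∉ vertex σ a
  fst_notMem_snd : u ∉ vertex σ w
  apply_ne : τ (σ (σ w)) ≠ σ (σ (σ w))

theorem IsCurve.bigon_notMem (h : IsCurve n σ τ)
    (huniv : vertex σ a ∪ vertex σ (τ (σ (σ a))) ≠ Set.univ) (hb : σ (τ (σ (τ a))) = a)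
    (hb' : σ (τ (σ (τ (σ (σ a))))) = σ (σ a)) : τ a ∉ vertex σ (τ (σ (σ a))) := by
  have hσ := h.quartic
  have hτ := h.pairing
  have hnodup := hσ.nodup a
  have hfst := hσ.apply_eq_of_bigon hb
  have hsnd := hσ.apply_eq_of_bigon hb'
  rw [hσ.apply_four] at hsnd
  have hu := hτ.apply_apply a
  have hw := hτ.apply_apply (σ (σ a))
  generalize hwdef : τ (σ (σ a)) = w at *
  generalize hudef : τ a = u at *
  simp only [List.nodup_cons, List.mem_cons, List.not_mem_nil, or_false, not_or] at hnodup
  rintro (rfl | rfl | rfl | rfl)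
  · exact hnodup.1.2.1 (hu.symm.trans hw)
  · exact hnodup.1.1 (hu.symm.trans hsnd)
  · refine huniv (h.eq_univ (a := a) (fun x => ?_) ?_ (Or.inl (by simp [mem_vertex])))
    · simp only [Set.mem_union, hσ.apply_mem_vertex]
    · have hsnd' := hτ.apply_eq_iff.1 hsnd
      have hfst' := hτ.apply_eq_iff.1 hfst
      rintro x ((rfl | rfl | rfl | rfl) | (rfl | rfl | rfl | rfl)) <;>
        simp [mem_vertex, hu, hw, hfst, hsnd, hudef, hwdef, ← hsnd', ← hfst']
  · rw [hσ.apply_four] at hfst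
    exact hnodup.2.2.1 (hw.symm.trans hfst)

theorem IsCurve.bigonChain (h : IsCurve n σ τ)
    (huniv : vertex σ a ∪ vertex σ (τ (σ (σ a))) ≠ Set.univ)
    (hloop : ∀ x ∈ vertex σ a, τ x ∉ vertex σ a) (hb : σ (τ (σ (τ a))) = a)
    (hb' : σ (τ (σ (τ (σ (σ a))))) = σ (σ a))
    (hne : τ (σ (σ (τ (σ (σ a))))) ≠ σ (σ (σ (τ (σ (σ a)))))) :
    BigonChain σ τ a (τ a) (τ (σ (σ a))) where
  apply_self := rfl
  apply_apply_fst := h.quartic.apply_eq_of_bigon hb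
  apply_opp := rfl
  apply_apply_snd := by rw [h.quartic.apply_eq_of_bigon hb', h.quartic.apply_four]
  fst_notMem := hloop a (by simp [mem_vertex])
  snd_notMem := hloop _ (by simp [mem_vertex])
  fst_notMem_snd := h.bigon_notMem huniv hb hb'
  apply_ne := hne

namespace BigonChain

theorem fst_notMem_union (hb : BigonChain σ τ a u w) : u ∉ vertex σ a ∪ vertex σ w := fun hu =>
  hu.elim hb.fst_notMem hb.fst_notMem_snd

theorem apply_fst_notMem_union (hσ : IsQuartic σ) (hb : BigonChain σ τ a u w) :
    σ u ∉ vertex σ a ∪ vertex σ w := by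
  simpa only [Set.mem_union, hσ.apply_mem_vertex] using hb.fst_notMem_union

theorem notMem_vertex_of_mem (hσ : IsQuartic σ) (hb : BigonChain σ τ a u w) {x : F}
    (hx : x ∈ vertex σ w) : x ∉ vertex σ a := by
  rcases hx with rfl | rfl | rfl | rfl <;> simpa only [hσ.apply_mem_vertex] using hb.snd_notMem

theorem apply_fst (hτ : IsPairing τ) (hb : BigonChain σ τ a u w) : τ u = a :=
  hb.apply_self ▸ hτ.apply_apply a

theorem apply_apply_apply_opp (hτ : IsPairing τ) (hb : BigonChain σ τ a u w) :
    τ (σ (σ (σ a))) = σ u :=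
  hb.apply_apply_fst ▸ hτ.apply_apply (σ u)

theorem apply_snd (hτ : IsPairing τ) (hb : BigonChain σ τ a u w) : τ w = σ (σ a) :=
  hb.apply_opp ▸ hτ.apply_apply _

theorem apply_apply_self (hτ : IsPairing τ) (hb : BigonChain σ τ a u w) : τ (σ a) = σ w :=
  hb.apply_apply_snd ▸ hτ.apply_apply (σ w)

theorem apply_notMem_union (hσ : IsQuartic σ) (hτ : IsPairing τ) (hb : BigonChain σ τ a u w)
    {x : F} (hx : x = σ (σ w) ∨ x = σ (σ (σ w))) : τ x ∉ vertex σ a ∪ vertex σ w := by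
  have hnodup := hσ.nodup w
  have hxW : x ∈ vertex σ w := by simp only [mem_vertex]; tauto
  have hxV := hb.notMem_vertex_of_mem hσ hxW
  have hu := hb.fst_notMem_snd
  have hσu : σ u ∉ vertex σ w := mt hσ.apply_mem_vertex.1 hu
  have hpartner : ∀ {y z}, τ x = y → τ y = z → x = z := fun hy hz =>
    (hτ.apply_eq_iff.1 hy).trans hz
  simp only [List.nodup_cons, List.mem_cons, List.not_mem_nil, or_false, not_or] at hnodup
  rintro ((hy | hy | hy | hy) | (hy | hy | hy | hy))
  · exact hu (hpartner hy hb.apply_self ▸ hxW)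
  · have := hpartner hy (hb.apply_apply_self hτ)
    grind
  · have := hpartner hy hb.apply_opp
    grind
  · exact hσu (hpartner hy (hb.apply_apply_apply_opp hτ) ▸ hxW)
  · exact hxV (hpartner hy (hb.apply_snd hτ) ▸ by simp [mem_vertex])
  · exact hxV (hpartner hy hb.apply_apply_snd ▸ by simp [mem_vertex])
  · rcases hx with rfl | rfl
    · exact hτ.apply_ne _ hy
    · exact hb.apply_ne (hpartner hy rfl).symm
  · rcases hx with rfl | rfl
    · exact hb.apply_ne hy
    · exact hτ.apply_ne _ hy

theorem exists_end (hσ : IsQuartic σ) (hb : BigonChain σ τ a u w) :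
    ∃ r : F → F, (∀ z, r z = u ∨ r z = σ u) ∧ r a = u ∧ r (σ a) = σ u ∧ r (σ (σ a)) = u ∧
      r (σ (σ (σ a))) = σ u ∧ r w = u ∧ r (σ w) = σ u ∧ r (σ (σ w)) = u ∧
      r (σ (σ (σ w))) = σ u := by
  classical
  have hV := hσ.nodup a
  have hW := hσ.nodup w
  have hdisj := fun x => hb.notMem_vertex_of_mem hσ (x := x)
  simp only [List.nodup_cons, List.mem_cons, List.not_mem_nil, or_false, not_or] at hV hW
  simp only [mem_vertex] at hdisj
  refine ⟨fun z => if z = a ∨ z = σ (σ a) ∨ z = w ∨ z = σ (σ w) then u else σ u,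
    fun z => ite_eq_or_eq _ _ _, ?_⟩
  clear hb
  grind

theorem end_notMem (hσ : IsQuartic σ) (hτ : IsPairing τ) (hb : BigonChain σ τ a u w) :
    τ (σ (σ w)) ∉ vertex σ (σ w) := fun hx =>
  hb.apply_notMem_union hσ hτ (Or.inl rfl) (Or.inr (hσ.vertex_apply w ▸ hx))

theorem joinedOn {τ' : Perm F} (hσ : IsQuartic σ) (hτ : IsPairing τ)
    (hb : BigonChain σ τ a u w) (hj : JoinedOn Set.univ (σ * σ) τ) (hu : τ' u = τ (σ (σ w)))
    (hσu : τ' (σ u) = τ (σ (σ (σ w)))) (hoff : AgreeOff (vertex σ a ∪ vertex σ w) τ τ') :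
    JoinedOn (vertex σ a ∪ vertex σ w)ᶜ (σ * σ) τ' := by
  obtain ⟨r, hr, ha₀, ha₁, ha₂, ha₃, hw₀, hw₁, hw₂, hw₃⟩ := hb.exists_end hσ
  have huS := hb.fst_notMem_union
  have hσuS := hb.apply_fst_notMem_union hσ
  rw [Set.compl_eq_univ_sdiff]
  refine hj.sdiff (r := r) hτ.apply_apply (fun z _ => ⟨trivial, ?_⟩) (fun z => ?_) ?_ ?_
    fun z hz => hoff z hz.2
  · rcases hr z with hz | hz <;> rwa [hz]
  · simp only [Perm.mul_apply, Set.mem_union, hσ.apply_mem_vertex]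
  · rintro z ((rfl | rfl | rfl | rfl) | (rfl | rfl | rfl | rfl)) <;>
      simp only [Perm.mul_apply, hσ.apply_four, ha₀, ha₁, ha₂, ha₃, hw₀, hw₁, hw₂, hw₃]
  · rintro z ((hz | hz | hz | hz) | (hz | hz | hz | hz)) <;> rw [hz]
    · exact Or.inr ⟨hb.apply_self ▸ huS, Or.inl (hb.apply_self.trans ha₀.symm)⟩
    · exact Or.inl (by simp [ha₁, hw₁, hb.apply_apply_self hτ, mem_vertex])
    · exact Or.inl (by simp [ha₂, hw₀, hb.apply_opp, mem_vertex])
    · have hσu' := hb.apply_apply_apply_opp hτ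
      exact Or.inr ⟨hσu' ▸ hσuS, Or.inl (hσu'.trans ha₃.symm)⟩
    · exact Or.inl (by simp [ha₂, hw₀, hb.apply_snd hτ, mem_vertex])
    · exact Or.inl (by simp [ha₁, hw₁, hb.apply_apply_snd, mem_vertex])
    · exact Or.inr ⟨hb.apply_notMem_union hσ hτ (Or.inl rfl), Or.inr (by rw [hw₂, hu])⟩
    · exact Or.inr ⟨hb.apply_notMem_union hσ hτ (Or.inr rfl), Or.inr (by rw [hw₃, hσu])⟩

theorem apply_notMem_of_mem (hσ : IsQuartic σ) (hτ : IsPairing τ) (hb : BigonChain σ τ a u w) :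
    ∀ x ∈ vertex σ a, τ x ∉ vertex σ a := by
  rintro x (rfl | rfl | rfl | rfl)
  · exact hb.apply_self ▸ hb.fst_notMem
  · exact hb.apply_apply_self hτ ▸ hb.notMem_vertex_of_mem hσ (by simp [mem_vertex])
  · exact hb.apply_opp ▸ hb.snd_notMem
  · exact hb.apply_apply_apply_opp hτ ▸ mt hσ.apply_mem_vertex.1 hb.fst_notMem

end BigonChain

section Slide

variable [DecidableEq F]

/-- Lets the two vertices of a chain of bigons float one after the other, which pulls the two
strands through the chain apart. -/
def unchain (σ τ : Perm F) (a w : F) : Perm F := extract σ (extract σ τ a) (σ w)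

theorem IsPairing.isPairing_unchain (hτ : IsPairing τ) (σ : Perm F) (a w : F) :
    IsPairing (unchain σ τ a w) :=
  (hτ.isPairing_extract σ a).isPairing_extract σ _

theorem floats_unchain_apply (hσ : IsQuartic σ) (hτ : IsPairing τ) (a w : F) :
    Floats σ (unchain σ τ a w) (σ w) :=
  floats_extract hσ (hτ.isPairing_extract σ a) _

theorem agreeOff_unchain (hσ : IsQuartic σ) (hτ : IsPairing τ) (a w : F) :
    AgreeOff (vertex σ a ∪ vertex σ w) τ (unchain σ τ a w) := fun z hz hτz => by
  rw [Set.mem_union, not_or] at hz hτz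
  have hfst : extract σ τ a z = τ z := extract_apply_of_notMem hτ hz.1 hτz.1
  rw [unchain, extract_apply_of_notMem (hτ.isPairing_extract σ a), hfst] <;>
    rw [hσ.vertex_apply]
  exacts [hz.2, hfst ▸ hτz.2]

namespace BigonChain

variable (hσ : IsQuartic σ) (hτ : IsPairing τ) (hb : BigonChain σ τ a u w)

include hσ hτ hb

theorem extract_apply_apply_snd : extract σ τ a (σ w) = u := by
  rw [← hb.apply_apply_self hτ, extract_apply_apply_of_mem hσ hτ (hb.apply_notMem_of_mem hσ hτ)
    (by simp [mem_vertex]), smooth_apply_apply, hb.apply_self]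

theorem extract_apply_snd : extract σ τ a w = σ u := by
  rw [← hb.apply_opp, extract_apply_apply_of_mem hσ hτ (hb.apply_notMem_of_mem hσ hτ)
    (by simp [mem_vertex]), hσ.isOpposite.smooth_apply_apply_apply, hb.apply_apply_apply_opp hτ]

theorem extract_apply_of_eq {x : F} (hx : x = σ (σ w) ∨ x = σ (σ (σ w))) :
    extract σ τ a x = τ x := by
  refine extract_apply_of_notMem hτ (hb.notMem_vertex_of_mem hσ ?_) fun hτx =>
    hb.apply_notMem_union hσ hτ hx (Or.inl hτx)
  simp only [mem_vertex]
  tauto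

theorem extract_apply_notMem_of_mem :
    ∀ x ∈ vertex σ (σ w), extract σ τ a x ∉ vertex σ (σ w) := by
  rw [hσ.vertex_apply]
  rintro x (rfl | rfl | rfl | rfl)
  · exact hb.extract_apply_snd hσ hτ ▸ mt hσ.apply_mem_vertex.1 hb.fst_notMem_snd
  · exact hb.extract_apply_apply_snd hσ hτ ▸ hb.fst_notMem_snd
  · rw [hb.extract_apply_of_eq hσ hτ (Or.inl rfl)]
    exact fun hx => hb.apply_notMem_union hσ hτ (Or.inl rfl) (Or.inr hx)
  · rw [hb.extract_apply_of_eq hσ hτ (Or.inr rfl)]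
    exact fun hx => hb.apply_notMem_union hσ hτ (Or.inr rfl) (Or.inr hx)

theorem unchain_apply_fst : unchain σ τ a w u = τ (σ (σ w)) := by
  rw [← hb.extract_apply_apply_snd hσ hτ, unchain, extract_apply_apply_of_mem hσ
    (hτ.isPairing_extract σ a) (hb.extract_apply_notMem_of_mem hσ hτ) (by simp [mem_vertex]),
    hσ.isOpposite.smooth_apply_self, hb.extract_apply_of_eq hσ hτ (Or.inl rfl)]

theorem unchain_apply_apply_fst : unchain σ τ a w (σ u) = τ (σ (σ (σ w))) := by
  rw [← hb.extract_apply_snd hσ hτ, unchain, extract_apply_apply_of_mem hσ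
    (hτ.isPairing_extract σ a) (hb.extract_apply_notMem_of_mem hσ hτ)
    (by simp [mem_vertex, hσ.apply_four])]
  nth_rw 2 [← hσ.apply_four w]
  rw [hσ.isOpposite.smooth_apply_apply_apply_apply, hb.extract_apply_of_eq hσ hτ (Or.inr rfl)]

theorem floats_unchain : Floats σ (unchain σ τ a w) a := by
  have hτ' := hτ.isPairing_extract σ a
  have hf := floats_extract hσ hτ a
  have heq : ∀ x ∈ vertex σ a, unchain σ τ a w x = extract σ τ a x := fun x hx =>
    have hdisj : ∀ y ∈ vertex σ a, y ∉ vertex σ (σ w) := fun y hy hyw =>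
      hb.notMem_vertex_of_mem hσ (hσ.vertex_apply w ▸ hyw) hy
    extract_apply_of_notMem hτ' (hdisj x hx) (hdisj _ ((hf.apply_mem_vertex hτ').2 hx))
  exact ⟨by rw [heq _ (by simp [mem_vertex]), hf.apply_self],
    by rw [heq _ (by simp [mem_vertex]), hf.apply_opp]⟩

theorem numCycles_add_four_le [Finite F] :
    numCycles (σ * τ) + 4 ≤ numCycles (σ * unchain σ τ a w) := by
  have hfst := numCycles_add_two_le_extract_of_forall_notMem hσ hτ (hb.apply_notMem_of_mem hσ hτ)
  have hsnd := numCycles_add_two_le_extract_of_forall_notMem hσ (hτ.isPairing_extract σ a)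
    (hb.extract_apply_notMem_of_mem hσ hτ)
  rw [unchain]
  omega

end BigonChain

/-- Lets the vertex of `a` float and moves the vertex of `w`, as a kink, to the edge where the
two vertices were. -/
def slide (σ τ : Perm F) (a w : F) : Perm F :=
  kink σ (unchain σ τ a w) (σ w) (τ (σ (σ w)))

namespace BigonChain

variable (hσ : IsQuartic σ) (hτ : IsPairing τ) (hb : BigonChain σ τ a u w)

include hσ hτ hb

theorem unchain_apply_end : unchain σ τ a w (τ (σ (σ w))) = u := by
  rw [← hb.unchain_apply_fst hσ hτ, (hτ.isPairing_unchain σ a w).apply_apply]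

theorem slide_apply_apply_snd : slide σ τ a w (σ w) = u := by
  rw [slide, kink_apply_self hσ (hτ.isPairing_unchain σ a w) (floats_unchain_apply hσ hτ a w)
    (hb.end_notMem hσ hτ), hb.unchain_apply_end hσ hτ]

theorem slide_apply_snd : slide σ τ a w w = τ (σ (σ w)) := by
  have hval := kink_apply_apply_opp hσ (hτ.isPairing_unchain σ a w)
    (floats_unchain_apply hσ hτ a w) (hb.end_notMem hσ hτ)
  rwa [hσ.apply_four] at hval

theorem slide_apply_of_ne {z : F} (hz : z ∉ vertex σ w) (hz' : z ≠ τ (σ (σ w))) (hzu : z ≠ u) :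
    slide σ τ a w z = unchain σ τ a w z :=
  kink_apply_of_ne (hτ.isPairing_unchain σ a w) (floats_unchain_apply hσ hτ a w)
    (hσ.vertex_apply w ▸ hz) hz' (hb.unchain_apply_end hσ hτ ▸ hzu)

theorem slide_apply_apply_fst : slide σ τ a w (σ u) = τ (σ (σ (σ w))) := by
  rw [hb.slide_apply_of_ne hσ hτ, hb.unchain_apply_apply_fst hσ hτ]
  · exact mt hσ.apply_mem_vertex.1 hb.fst_notMem_snd
  · intro hend
    refine hb.notMem_vertex_of_mem hσ (x := σ (σ w)) (by simp [mem_vertex]) ?_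
    rw [← hτ.apply_eq_iff.2 hend, hb.apply_apply_fst]
    simp [mem_vertex]
  · exact hσ.isOpposite.apply_ne u

theorem agreeOff_slide : AgreeOff (vertex σ a ∪ vertex σ w) τ (slide σ τ a w) :=
  fun z hz hτz => by
    rw [hb.slide_apply_of_ne hσ hτ (fun hzw => hz (Or.inr hzw)),
      agreeOff_unchain hσ hτ a w z hz hτz]
    · rintro rfl
      exact hτz (Or.inr (by simp [mem_vertex, hτ.apply_apply]))
    · rintro rfl
      exact hτz (Or.inl (by simp [mem_vertex, hb.apply_fst hτ]))

theorem floats_slide : Floats σ (slide σ τ a w) a := by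
  have hf := hb.floats_unchain hσ hτ
  have heq : ∀ x ∈ vertex σ a, slide σ τ a w x = unchain σ τ a w x := fun x hx => by
    refine hb.slide_apply_of_ne hσ hτ (fun hxw => hb.notMem_vertex_of_mem hσ hxw hx) ?_ ?_
    · rintro rfl
      exact hb.apply_notMem_union hσ hτ (Or.inl rfl) (Or.inl hx)
    · rintro rfl
      exact hb.fst_notMem hx
  exact ⟨by rw [heq _ (by simp [mem_vertex]), hf.apply_self],
    by rw [heq _ (by simp [mem_vertex]), hf.apply_opp]⟩

theorem joinedOn_slide (hj : JoinedOn Set.univ (σ * σ) τ) :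
    JoinedOn (vertex σ a)ᶜ (σ * σ) (slide σ τ a w) := by
  have hτ' := hτ.isPairing_unchain σ a w
  have hset : (vertex σ a)ᶜ = (vertex σ a ∪ vertex σ w)ᶜ ∪ vertex σ (σ w) := by
    rw [hσ.vertex_apply]
    ext x
    have := hb.notMem_vertex_of_mem hσ (x := x)
    by_cases hxw : x ∈ vertex σ w <;> simp_all
  have hend := hb.apply_notMem_union hσ hτ (Or.inl rfl)
  rw [hset]
  refine joinedOn_kink hσ hτ' (floats_unchain_apply hσ hτ a w) ?_ hend
    (hb.unchain_apply_end hσ hτ ▸ hb.fst_notMem_union) (hb.joinedOn hσ hτ hj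
      (hb.unchain_apply_fst hσ hτ) (hb.unchain_apply_apply_fst hσ hτ) (agreeOff_unchain hσ hτ a w))
  rw [hσ.vertex_apply, Set.disjoint_left]
  exact fun x hx hxw => hx (Or.inr hxw)

end BigonChain

end Slide

theorem IsCurve.detachable_of_bigonChain [Finite F] (h : IsCurve n σ τ)
    (hb : BigonChain σ τ a u w) : Detachable n σ τ a := by
  classical
  have hσ := h.quartic
  have hτ := h.pairing
  have hτ' := hτ.isPairing_unchain σ a w
  have hfst := hb.slide_apply_apply_snd hσ hτ
  have hoff := hb.agreeOff_slide hσ hτ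
  refine ⟨slide σ τ a w, σ w, 1, ⟨hτ'.isPairing_kink _ _ _, hb.floats_slide hσ hτ,
    hb.joinedOn_slide hσ hτ h.joined, ?_⟩, ?_, by norm_num, by rwa [detachRegion, hb.apply_opp]⟩
  · have hunchain := hb.numCycles_add_four_le hσ hτ
    have hkink := numCycles_le_numCycles_mul_kink_add_two hσ hτ' (floats_unchain_apply hσ hτ a w)
      (τ (σ (σ w)))
    have hfaces := h.le_faces
    rw [slide]
    omega
  · refine Code.bigons _ ?_ (hb.apply_apply_self hτ) ?_ ?_ ?_ ?_ ?_
    · rw [hfst, hb.apply_self]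
    · rw [hσ.apply_four, hb.apply_opp]
    · rw [hfst, hb.apply_apply_apply_opp hτ]
    · rw [hσ.apply_four, hb.slide_apply_snd hσ hτ]
    · rw [hfst, hb.slide_apply_apply_fst hσ hτ]
    · rwa [hσ.vertex_apply]

end Bigons

section Count

variable {F : Type*} {n : ℕ} {σ τ : Perm F} {a : F}

/-- The sum of `f` over the flags of the vertex of `a`. -/
def vertexSum (σ : Perm F) (f : F → ℚ) (a : F) : ℚ :=
  f a + f (σ a) + f (σ (σ a)) + f (σ (σ (σ a)))

theorem IsQuartic.vertexSum_apply (h : IsQuartic σ) (f : F → ℚ) (a : F) :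
    vertexSum σ f (σ a) = vertexSum σ f a := by
  simp only [vertexSum, h.apply_four]
  ring

theorem sum_vertexSum [Fintype F] (σ : Perm F) (f : F → ℚ) :
    ∑ a, vertexSum σ f a = 4 * ∑ a, f a := by
  have hshift : ∀ g : F → ℚ, ∑ a, g (σ a) = ∑ a, g a := Equiv.sum_comp σ
  simp only [vertexSum, Finset.sum_add_distrib, hshift fun a => f (σ (σ a)),
    hshift fun a => f (σ a), hshift f]
  ring

theorem IsCurve.apply_notMem_of_forall_apply_ne (h : IsCurve n σ τ)
    (hmono : ∀ x ∈ vertex σ a, σ (τ x) ≠ x) : ∀ x ∈ vertex σ a, τ x ∉ vertex σ a := by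
  have hσ := h.quartic
  have hnext : ∀ x ∈ vertex σ a, τ x ≠ σ x := fun x hx hτx =>
    hmono (σ x) (hσ.apply_mem_vertex.2 hx) (by rw [← hτx, h.pairing.apply_apply, hτx])
  have hprev : ∀ x ∈ vertex σ a, τ x ≠ σ (σ (σ x)) := fun x hx hτx =>
    hmono x hx (by rw [hτx, hσ.apply_four])
  have hvertex : ∀ x ∈ vertex σ a, vertex σ x = vertex σ a := by
    rintro x (rfl | rfl | rfl | rfl) <;> simp only [hσ.vertex_apply]
  intro x hx hτx
  rw [← hvertex x hx] at hτx
  rcases hτx with hτx | hτx | hτx | hτx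
  exacts [h.pairing.apply_ne x hτx, hnext x hx hτx, h.apply_ne_opp x hτx, hprev x hx hτx]

theorem union_vertex_ne_univ [Finite F] (hσ : IsQuartic σ) (hF : 12 < Nat.card F) (a b c : F) :
    vertex σ a ∪ vertex σ b ∪ vertex σ c ≠ Set.univ := by
  intro huniv
  have hvertex : ∀ x, (vertex σ x).ncard = 4 := fun x =>
    hσ.isOpposite.ncard_vertex (hσ.apply_apply_ne x)
  have hle := (Set.ncard_union_le (vertex σ a ∪ vertex σ b) (vertex σ c)).trans
    (Nat.add_le_add_right (Set.ncard_union_le _ _) _)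
  rw [huniv, Set.ncard_univ, hvertex, hvertex, hvertex] at hle
  omega

theorem IsCurve.union_vertex_eq_univ (h : IsCurve n σ τ) (hb : σ (τ (σ (τ a))) = a)
    (hb' : σ (τ (σ (τ (σ (σ a))))) = σ (σ a)) (hu : τ (σ (σ (τ a))) = σ (σ (σ (τ a))))
    (hw : τ (σ (σ (τ (σ (σ a))))) = σ (σ (σ (τ (σ (σ a)))))) :
    vertex σ a ∪ vertex σ (τ (σ (σ a))) ∪ vertex σ (τ a) = Set.univ := by
  have hσ := h.quartic
  have hτ := h.pairing
  have hfst := hσ.apply_eq_of_bigon hb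
  have hsnd := hσ.apply_eq_of_bigon hb'
  rw [hσ.apply_four] at hsnd
  refine h.eq_univ (a := a) (fun x => ?_) ?_ (by simp [mem_vertex])
  · simp only [Set.mem_union, hσ.apply_mem_vertex]
  · have hu' := hτ.apply_eq_iff.1 hu
    have hw' := hτ.apply_eq_iff.1 hw
    have hfst' := hτ.apply_eq_iff.1 hfst
    have hsnd' := hτ.apply_eq_iff.1 hsnd
    rintro x (((rfl | rfl | rfl | rfl) | (rfl | rfl | rfl | rfl)) | (rfl | rfl | rfl | rfl)) <;>
      simp [mem_vertex, hτ.apply_apply, hfst, hsnd, hu, hw, ← hu', ← hw', ← hfst', ← hsnd']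

theorem IsQuartic.smoothOpp_apply_apply [DecidableEq F] (hσ : IsQuartic σ) (a : F) :
    smoothOpp σ (σ * σ) (σ (σ a)) = smoothOpp σ (σ * σ) a := by
  have hopp := hσ.isOpposite
  have hvertex : vertex σ (σ (σ a)) = vertex σ a := by simp only [hσ.vertex_apply]
  ext x
  by_cases hx : x ∈ vertex σ a
  · rw [hopp.smoothOpp_apply_of_mem (hσ.apply_apply_ne a) hx,
      hopp.smoothOpp_apply_of_mem (hσ.apply_apply_ne _) (hvertex ▸ hx), smooth, smooth,
      hσ.apply_four, swap_comm]
  · rw [hopp.smoothOpp_apply_of_notMem hx, hopp.smoothOpp_apply_of_notMem (hvertex ▸ hx)]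

variable [Finite F]

namespace IsCurve

theorem detachable_or_detachable_of_bigons (h : IsCurve n σ τ) (hF : 12 < Nat.card F)
    (hloop : ∀ x ∈ vertex σ a, τ x ∉ vertex σ a) (hb : σ (τ (σ (τ a))) = a)
    (hb' : σ (τ (σ (τ (σ (σ a))))) = σ (σ a)) :
    Detachable n σ τ a ∨ Detachable n σ τ (σ (σ a)) := by
  have hσ := h.quartic
  have huniv : ∀ b, vertex σ a ∪ vertex σ b ≠ Set.univ := fun b hab =>
    union_vertex_ne_univ hσ hF a b b (by rw [hab, Set.univ_union])
  have hvertex : vertex σ (σ (σ a)) = vertex σ a := by simp only [hσ.vertex_apply]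
  by_cases hw : τ (σ (σ (τ (σ (σ a))))) = σ (σ (σ (τ (σ (σ a)))))
  · by_cases hu : τ (σ (σ (τ a))) = σ (σ (σ (τ a)))
    · exact absurd (h.union_vertex_eq_univ hb hb' hu hw) (union_vertex_ne_univ hσ hF _ _ _)
    · refine Or.inr (h.detachable_of_bigonChain (h.bigonChain ?_ ?_ hb' ?_ ?_)) <;>
        simpa only [hσ.apply_four, hvertex] using by first | exact huniv _ | assumption
  · exact Or.inl (h.detachable_of_bigonChain (h.bigonChain (huniv _) hloop hb hb' hw))

theorem five_le_minimalPeriod_add (h : IsCurve n σ τ) (hF : 12 < Nat.card F)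
    (hmono : ∀ x ∈ vertex σ a, σ (τ x) ≠ x) (hd : ∀ x ∈ vertex σ a, ¬ Detachable n σ τ x) :
    5 ≤ Function.minimalPeriod (σ * τ) a + Function.minimalPeriod (σ * τ) (σ (σ a)) := by
  have ha := two_le_minimalPeriod_mul (hmono a (by simp [mem_vertex]))
  have hopp := two_le_minimalPeriod_mul (hmono (σ (σ a)) (by simp [mem_vertex]))
  have hbigon : ∀ x, Function.minimalPeriod (σ * τ) x = 2 → σ (τ (σ (τ x))) = x := fun x hx => by
    have hperiod := Function.iterate_minimalPeriod (f := σ * τ) (x := x)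
    rwa [hx] at hperiod
  by_contra! hlt
  rcases h.detachable_or_detachable_of_bigons hF (h.apply_notMem_of_forall_apply_ne hmono)
    (hbigon a (by omega)) (hbigon _ (by omega)) with ha | hopp
  exacts [hd _ (by simp [mem_vertex]) ha, hd _ (by simp [mem_vertex]) hopp]

theorem thirteen_le_minimalPeriod [DecidableEq F] (h : IsCurve n σ τ)
    (hn : Nat.card F = 4 * n) (hV : vertex σ a ≠ Set.univ)
    (hloop : ∀ x ∈ vertex σ a, τ x ∉ vertex σ a)
    (hc : JoinedOn Set.univ (smoothOpp σ (σ * σ) a) τ) (hd : ¬ Detachable n σ τ a) :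
    13 ≤ Function.minimalPeriod (σ * τ) a := by
  by_contra! hlt
  exact hd (h.detachable_of_corner hn hV hc hloop (by omega))

theorem vertexSum_inv_le_of_joinedOn_smoothOpp [DecidableEq F] (h : IsCurve n σ τ)
    (hn : Nat.card F = 4 * n) (hn4 : 4 ≤ n) (hc : JoinedOn Set.univ (smoothOpp σ (σ * σ) a) τ)
    (hd : ∀ x ∈ vertex σ a, ¬ Detachable n σ τ x) :
    vertexSum σ (fun x => 1 / Function.minimalPeriod (σ * τ) x) a ≤ 77 / 78 := by
  have hσ := h.quartic
  have hF : 12 < Nat.card F := by omega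
  have hV : ∀ b, vertex σ b ≠ Set.univ := fun b hb =>
    union_vertex_ne_univ hσ hF b b b (by rw [hb, Set.univ_union, Set.univ_union])
  have hmono : ∀ x ∈ vertex σ a, σ (τ x) ≠ x := fun x hx hfix =>
    hd x hx (h.detachable_of_loop (hV x) hfix)
  have hloop := h.apply_notMem_of_forall_apply_ne hmono
  have hdeg₀ := h.thirteen_le_minimalPeriod hn (hV a) hloop hc (hd a (by simp [mem_vertex]))
  have hdeg₂ := h.thirteen_le_minimalPeriod hn (hV _) (by simpa only [hσ.vertex_apply] using hloop)
    (by rwa [hσ.smoothOpp_apply_apply]) (hd (σ (σ a)) (by simp [mem_vertex]))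
  have hdeg₁ := two_le_minimalPeriod_mul (hmono (σ a) (by simp [mem_vertex]))
  have hdeg₃ := two_le_minimalPeriod_mul (hmono (σ (σ (σ a))) (by simp [mem_vertex]))
  have hdeg₁₃ := h.five_le_minimalPeriod_add hF (a := σ a)
    (by simpa only [hσ.vertex_apply] using hmono) (by simpa only [hσ.vertex_apply] using hd)
  have hinv : ∀ {m k : ℕ}, 0 < k → k ≤ m → (1 : ℚ) / m ≤ 1 / k := fun hk hkm =>
    one_div_le_one_div_of_le (by exact_mod_cast hk) (by exact_mod_cast hkm)
  have hinv₀ := hinv (by norm_num) hdeg₀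
  have hinv₁ := hinv (by norm_num) hdeg₁
  have hinv₂ := hinv (by norm_num) hdeg₂
  have hinv₃ := hinv (by norm_num) hdeg₃
  rw [vertexSum]
  rcases le_or_gt 3 (Function.minimalPeriod (σ * τ) (σ a)) with hthree | hthree
  · have hinv₁' := hinv (by norm_num) hthree
    norm_num at hinv₀ hinv₁' hinv₂ hinv₃ ⊢
    linarith
  · have hinv₃' := hinv (k := 3) (by norm_num)
      (show 3 ≤ Function.minimalPeriod (σ * τ) (σ (σ (σ a))) by omega)
    norm_num at hinv₀ hinv₁ hinv₂ hinv₃' ⊢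
    linarith

theorem vertexSum_inv_le (h : IsCurve n σ τ) (hn : Nat.card F = 4 * n) (hn4 : 4 ≤ n)
    (hd : ∀ x ∈ vertex σ a, ¬ Detachable n σ τ x) :
    vertexSum σ (fun x => 1 / Function.minimalPeriod (σ * τ) x) a ≤ 77 / 78 := by
  classical
  have hσ := h.quartic
  rcases hσ.isOpposite.joinedOn_smooth_or_joinedOn_smooth h.pairing h.joined
    (hσ.apply_apply_ne a) with hc | hc
  · exact h.vertexSum_inv_le_of_joinedOn_smoothOpp hn hn4 hc hd
  · rw [← hσ.vertexSum_apply]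
    exact h.vertexSum_inv_le_of_joinedOn_smoothOpp hn hn4 hc (by rwa [hσ.vertex_apply])

theorem vertexSum_inv_le_add (h : IsCurve n σ τ) (hn : Nat.card F = 4 * n) (hn4 : 4 ≤ n) (a : F) :
    vertexSum σ (fun x => 1 / Function.minimalPeriod (σ * τ) x) a ≤
      77 / 78 + 4 * vertexSum σ ({x | Detachable n σ τ x}.indicator 1) a := by
  have hind : ∀ x, (0 : ℚ) ≤ {x | Detachable n σ τ x}.indicator 1 x :=
    Set.indicator_nonneg fun _ _ => zero_le_one
  have hind₀ := hind a
  have hind₁ := hind (σ a)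
  have hind₂ := hind (σ (σ a))
  have hind₃ := hind (σ (σ (σ a)))
  by_cases hd : ∀ x ∈ vertex σ a, ¬ Detachable n σ τ x
  · have hle := h.vertexSum_inv_le hn hn4 hd
    have hnonneg : 0 ≤ vertexSum σ ({x | Detachable n σ τ x}.indicator 1) a := by
      rw [vertexSum]
      linarith
    linarith
  · push Not at hd
    obtain ⟨x, hx, hxd⟩ := hd
    have hind_eq : {x | Detachable n σ τ x}.indicator (1 : F → ℚ) x = 1 :=
      Set.indicator_of_mem (s := {x | Detachable n σ τ x}) hxd 1
    have hinv : ∀ y, (1 : ℚ) / Function.minimalPeriod (σ * τ) y ≤ 1 := fun y =>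
      (div_le_one (by exact_mod_cast minimalPeriod_pos _ y)).2
        (by exact_mod_cast minimalPeriod_pos _ y)
    have hinv₀ := hinv a
    have hinv₁ := hinv (σ a)
    have hinv₂ := hinv (σ (σ a))
    have hinv₃ := hinv (σ (σ (σ a)))
    rw [vertexSum, vertexSum]
    rcases hx with rfl | rfl | rfl | rfl <;> linarith

theorem le_ncard_detachable (h : IsCurve n σ τ) (hn : Nat.card F = 4 * n) (hn4 : 4 ≤ n) :
    n ≤ 312 * {a | Detachable n σ τ a}.ncard := by
  have := Fintype.ofFinite F
  have : Nonempty F := (Nat.card_pos_iff.1 (by omega)).1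
  have hsum := Finset.sum_le_sum (s := Finset.univ) fun a _ => h.vertexSum_inv_le_add hn hn4 a
  have hind : ∑ a, {a | Detachable n σ τ a}.indicator (1 : F → ℚ) a =
      {a | Detachable n σ τ a}.ncard := by
    classical
    simp only [Set.indicator_apply, Pi.one_apply, Finset.sum_boole, ← Set.ncard_coe_finset,
      Finset.coe_filter, Finset.mem_univ, true_and, Set.mem_ofPred_eq]
  rw [sum_vertexSum, sum_inv_minimalPeriod, h.numCycles_eq hn, Finset.sum_add_distrib,
    ← Finset.mul_sum, sum_vertexSum, hind, Finset.sum_const, Finset.card_univ,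
    ← Nat.card_eq_fintype_card, hn, nsmul_eq_mul] at hsum
  have hle : (n : ℚ) ≤ 312 * {a | Detachable n σ τ a}.ncard := by
    push_cast at hsum
    linarith
  exact_mod_cast hle

end IsCurve

end Count

section SimpleFace

variable {F : Type*} {σ τ τ' : Perm F} {a b : F} {j : ℕ}

/-- The face of `b` has degree `j` and lies on one side only of the edge of `b`, so that a vertex
put on that edge enlarges the face. -/
structure HasSimpleFace (σ τ : Perm F) (j : ℕ) (b : F) : Prop where
  minimalPeriod_eq : Function.minimalPeriod (σ * τ) b = j
  iterate_ne : ∀ i, (σ * τ)^[i] b ≠ τ b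

theorem minimalPeriod_eq_of_iterate_eq {f g : F → F} {x : F} (h : ∀ i, f^[i] x = g^[i] x) :
    Function.minimalPeriod f x = Function.minimalPeriod g x :=
  Function.minimalPeriod_eq_minimalPeriod_iff.2 fun i => by
    rw [Function.IsPeriodicPt, Function.IsPeriodicPt, Function.IsFixedPt, Function.IsFixedPt, h]

theorem HasSimpleFace.of_agreeOff {S : Set F} (h : HasSimpleFace σ τ j b)
    (hS : ∀ x, σ x ∈ S ↔ x ∈ S) (hoff : AgreeOff S τ τ') (hb : ∀ i, (σ * τ)^[i] b ∉ S) :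
    HasSimpleFace σ τ' j b := by
  have hτ : ∀ i, τ' ((σ * τ)^[i] b) = τ ((σ * τ)^[i] b) := fun i => by
    refine hoff _ (hb i) (mt (hS _).2 ?_)
    rw [← Perm.mul_apply, ← Function.iterate_succ_apply' (σ * τ)]
    exact hb (i + 1)
  have hiter : ∀ i, (σ * τ')^[i] b = (σ * τ)^[i] b := fun i => by
    induction i with
    | zero => rfl
    | succ i ih =>
      rw [Function.iterate_succ_apply', Function.iterate_succ_apply', ih, Perm.mul_apply,
        Perm.mul_apply, hτ]
  exact ⟨(minimalPeriod_eq_of_iterate_eq hiter).trans h.minimalPeriod_eq, fun i => by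
    rw [hiter, show τ' b = τ b from hτ 0]
    exact h.iterate_ne i⟩

theorem iterate_mul_notMem_vertex (hσ : IsQuartic σ) (hτ : IsPairing τ) (hf : Floats σ τ a)
    (hb : b ∉ vertex σ a) (i : ℕ) : (σ * τ)^[i] b ∉ vertex σ a := by
  induction i with
  | zero => exact hb
  | succ i ih =>
    rwa [Function.iterate_succ_apply', Perm.mul_apply, hσ.apply_mem_vertex,
      hf.apply_mem_vertex hτ]

variable [DecidableEq F]

theorem hasSimpleFace_one_kink (hσ : IsQuartic σ) (hτ : IsPairing τ) (a b : F) :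
    HasSimpleFace σ (kink σ τ a b) 1 (σ (σ a)) := by
  have hopp : kink σ τ a b (σ (σ a)) = σ a := kink_apply_opp hσ hτ
  have hfix : (σ * kink σ τ a b) (σ (σ a)) = σ (σ a) := by rw [Perm.mul_apply, hopp]
  refine ⟨Function.minimalPeriod_eq_one_iff_isFixedPt.2 hfix, fun i => ?_⟩
  rw [Function.iterate_fixed hfix, hopp]
  exact hσ.isOpposite.apply_ne _

namespace HasSimpleFace

theorem iterate_mul_kink (h : HasSimpleFace σ τ j b) (hσ : IsQuartic σ) (hτ : IsPairing τ)
    (hf : Floats σ τ a) (hb : b ∉ vertex σ a) {i : ℕ} (hi : i < j) :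
    (σ * kink σ τ a b)^[i + 1] a = (σ * τ)^[i + 1] b := by
  induction i with
  | zero => simp only [zero_add, Function.iterate_one, Perm.mul_apply, kink_apply_self hσ hτ hf hb]
  | succ i ih =>
    have hne : (σ * τ)^[i + 1] b ≠ b :=
      Function.not_isPeriodicPt_of_pos_of_lt_minimalPeriod i.succ_ne_zero
        (h.minimalPeriod_eq.symm ▸ hi)
    rw [Function.iterate_succ_apply', ih (by omega), Function.iterate_succ_apply' _ (i + 1) b,
      Perm.mul_apply, Perm.mul_apply, kink_apply_of_ne hτ hf
        (iterate_mul_notMem_vertex hσ hτ hf hb _) hne (h.iterate_ne _)]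

theorem iterate_mul_kink_eq_or (h : HasSimpleFace σ τ j b) (hσ : IsQuartic σ) (hτ : IsPairing τ)
    (hf : Floats σ τ a) (hb : b ∉ vertex σ a) (i : ℕ) :
    (σ * kink σ τ a b)^[i] a = a ∨ ∃ m, (σ * kink σ τ a b)^[i] a = (σ * τ)^[m] b := by
  induction i with
  | zero => exact Or.inl rfl
  | succ i ih =>
    rw [Function.iterate_succ_apply', Perm.mul_apply]
    rcases ih with ha | ⟨m, hm⟩
    · exact Or.inr ⟨1, by rw [ha, kink_apply_self hσ hτ hf hb, Function.iterate_one,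
        Perm.mul_apply]⟩
    · rw [hm]
      by_cases hmb : (σ * τ)^[m] b = b
      · exact Or.inl (by rw [hmb, kink_apply_right hσ hτ hf hb, hσ.apply_four])
      · exact Or.inr ⟨m + 1, by rw [Function.iterate_succ_apply', Perm.mul_apply,
          kink_apply_of_ne hτ hf (iterate_mul_notMem_vertex hσ hτ hf hb m) hmb (h.iterate_ne m)]⟩

theorem kink [Finite F] (h : HasSimpleFace σ τ j b) (hσ : IsQuartic σ) (hτ : IsPairing τ)
    (hf : Floats σ τ a) (hb : b ∉ vertex σ a) :
    HasSimpleFace σ (kink σ τ a b) (j + 1) a := by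
  have hne : ∀ i, (σ * τ)^[i] b ≠ a := fun i hi =>
    iterate_mul_notMem_vertex hσ hτ hf hb i (hi ▸ Or.inl rfl)
  have hiter {i : ℕ} (hi : i < j) := h.iterate_mul_kink hσ hτ hf hb hi
  obtain ⟨i, rfl⟩ : ∃ i, j = i + 1 :=
    Nat.exists_eq_succ_of_ne_zero (h.minimalPeriod_eq ▸ (minimalPeriod_pos _ _).ne')
  have hperiod : (σ * PlaneCurve.kink σ τ a b)^[i + 2] a = a := by
    have hb' : (σ * τ)^[i + 1] b = b :=
      h.minimalPeriod_eq ▸ Function.iterate_minimalPeriod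
    rw [Function.iterate_succ_apply', hiter (by omega), hb', Perm.mul_apply,
      kink_apply_right hσ hτ hf hb, hσ.apply_four]
  refine ⟨le_antisymm (Function.IsPeriodicPt.minimalPeriod_le (by omega) hperiod) ?_, fun m => ?_⟩
  · by_contra! hlt
    obtain ⟨m, hm⟩ :=
      Nat.exists_eq_succ_of_ne_zero (minimalPeriod_pos (σ * PlaneCurve.kink σ τ a b) a).ne'
    have hmin := Function.iterate_minimalPeriod (f := σ * PlaneCurve.kink σ τ a b) (x := a)
    rw [hm, Nat.succ_eq_add_one, hiter (by omega)] at hmin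
    exact hne _ hmin
  · rw [kink_apply_self hσ hτ hf hb]
    rcases h.iterate_mul_kink_eq_or hσ hτ hf hb m with ha | ⟨l, hl⟩
    · rw [ha]
      rintro rfl
      exact hb ((hf.apply_mem_vertex hτ).1 (by simp [mem_vertex]))
    · rw [hl]
      exact h.iterate_ne l

end HasSimpleFace

end SimpleFace

section Reattach

variable {F : Type*} [DecidableEq F] {n : ℕ} {σ τ κ : Perm F} {a b : F}

/-- `κ` arises from `τ` by detaching the vertex of `a` and reattaching it as a kink on the edge
of `b`. -/
def Reattached (n : ℕ) (σ τ : Perm F) (a b : F) (κ : Perm F) : Prop :=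
  ∃ τ', DetachesTo n σ τ a τ' ∧ b ∉ vertex σ a ∧ κ = kink σ τ' a b

theorem Detachable.exists_reattached (h : Detachable n σ τ a) (hb : b ∉ vertex σ a) :
    ∃ κ, Reattached n σ τ a b κ :=
  let ⟨τ', hd⟩ := h
  ⟨_, τ', hd, hb, rfl⟩

namespace Reattached

theorem isCurve [Finite F] (h : Reattached n σ τ a b κ) (hσ : IsQuartic σ) : IsCurve n σ κ := by
  obtain ⟨τ', ⟨-, -, hd, -⟩, hb, rfl⟩ := h
  have hτb : τ' b ∈ (vertex σ a)ᶜ := mt (hd.floats.apply_mem_vertex hd.pairing).1 hb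
  have hj := joinedOn_kink hσ hd.pairing hd.floats disjoint_compl_left hb hτb hd.joined
  rw [Set.compl_union_self] at hj
  have hle := numCycles_le_numCycles_mul_kink_add_two hσ hd.pairing hd.floats b
  have hfaces := hd.le_faces
  exact ⟨hσ, hd.pairing.isPairing_kink σ a b, hj, by omega⟩

theorem hasSimpleFace_one (h : Reattached n σ τ a b κ) (hσ : IsQuartic σ) :
    HasSimpleFace σ κ 1 (σ (σ a)) := by
  obtain ⟨τ', ⟨-, -, hd, -⟩, -, rfl⟩ := h
  exact hasSimpleFace_one_kink hσ hd.pairing a b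

theorem hasSimpleFace_add_one [Finite F] {j : ℕ} (h : Reattached n σ τ a b κ) (hσ : IsQuartic σ)
    (hface : HasSimpleFace σ τ j b) (hfar : ∀ i, (σ * τ)^[i] b ∉ detachRegion σ τ a) :
    HasSimpleFace σ κ (j + 1) a := by
  obtain ⟨τ', ⟨-, -, hd, -, -, hoff⟩, hb, rfl⟩ := h
  have hS : ∀ x, σ x ∈ detachRegion σ τ a ↔ x ∈ detachRegion σ τ a := fun x => by
    simp only [detachRegion, Set.mem_union, hσ.apply_mem_vertex]
  exact (hface.of_agreeOff hS hoff hfar).kink hσ hd.pairing hd.floats hb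

end Reattached

theorem kink_injective {τ₁ τ₂ : Perm F} {b₁ b₂ : F} (hσ : IsQuartic σ) (hτ₁ : IsPairing τ₁)
    (hτ₂ : IsPairing τ₂) (hf₁ : Floats σ τ₁ a) (hf₂ : Floats σ τ₂ a) (hb₁ : b₁ ∉ vertex σ a)
    (hb₂ : b₂ ∉ vertex σ a) (h : kink σ τ₁ a b₁ = kink σ τ₂ a b₂) : τ₁ = τ₂ ∧ b₁ = b₂ := by
  obtain rfl : b₁ = b₂ := by
    rw [← kink_apply_apply_opp hσ hτ₁ hf₁ hb₁, h, kink_apply_apply_opp hσ hτ₂ hf₂ hb₂]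
  have hb : τ₁ b₁ = τ₂ b₁ := by
    rw [← kink_apply_self hσ hτ₁ hf₁ hb₁, h, kink_apply_self hσ hτ₂ hf₂ hb₂]
  refine ⟨?_, rfl⟩
  ext z
  by_cases hz : z ∈ vertex σ a
  · rcases hz with rfl | rfl | rfl | rfl
    · rw [hf₁.apply_self, hf₂.apply_self]
    · rw [hf₁.apply_apply_self hτ₁, hf₂.apply_apply_self hτ₂]
    · rw [hf₁.apply_opp, hf₂.apply_opp]
    · rw [hf₁.apply_apply_opp hτ₁, hf₂.apply_apply_opp hτ₂]
  by_cases hzb : z = b₁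
  · rw [hzb, hb]
  by_cases hzb' : z = τ₁ b₁
  · rw [hzb', hτ₁.apply_apply, hb, hτ₂.apply_apply]
  rw [← kink_apply_of_ne hτ₁ hf₁ hz hzb hzb', h, kink_apply_of_ne hτ₂ hf₂ hz hzb (hb ▸ hzb')]

theorem ncard_reattached_le [Finite F] (hσ : IsQuartic σ) (a : F) (κ : Perm F) :
    {p : Perm F × F | IsPairing p.1 ∧ Reattached n σ p.1 a p.2 κ}.ncard ≤ Nat.card F * 13 := by
  have hcode : ∀ p : Perm F × F, Reattached n σ p.1 a p.2 κ → ∃ τ' : Perm F, ∃ c : F × Fin 13,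
      Detached n σ τ' a ∧ Code σ p.1 τ' a c.1 c.2 ∧ p.2 ∉ vertex σ a ∧ κ = kink σ τ' a p.2 := by
    rintro p ⟨τ', ⟨m, i, hd, hc, hi, -⟩, hb, hκ⟩
    exact ⟨τ', (m, ⟨i, hi⟩), hd, hc, hb, hκ⟩
  have : Nonempty F := ⟨a⟩
  choose! detach code hspec using hcode
  rw [show Nat.card F * 13 = (Set.univ : Set (F × Fin 13)).ncard by
    rw [Set.ncard_univ, Nat.card_prod, Nat.card_fin]]
  refine Set.ncard_le_ncard_of_injOn code (fun _ _ => Set.mem_univ _) ?_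
  rintro ⟨τ₁, b₁⟩ ⟨hτ₁, hr₁⟩ ⟨τ₂, b₂⟩ ⟨hτ₂, hr₂⟩ hcode
  obtain ⟨hd₁, hc₁, hb₁, hκ₁⟩ := hspec _ hr₁
  obtain ⟨hd₂, hc₂, hb₂, hκ₂⟩ := hspec _ hr₂
  obtain ⟨hdetach, hb⟩ := kink_injective hσ hd₁.pairing hd₂.pairing hd₁.floats hd₂.floats hb₁ hb₂
    (hκ₁.symm.trans hκ₂)
  rw [hcode, hdetach] at hc₁
  exact Prod.ext (hc₁.unique hτ₁ hτ₂ hc₂) hb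

end Reattach

section Transfer

variable {F : Type*} [Finite F] {n : ℕ} {σ τ : Perm F}

theorem ncard_setOf_exists_mem_vertex_le (hσ : IsQuartic σ) (X : Set F) :
    {a | ∃ x ∈ X, x ∈ vertex σ a}.ncard ≤ 4 * X.ncard := by
  have hsub : {a | ∃ x ∈ X, x ∈ vertex σ a} ⊆
      X ∪ σ '' X ∪ (σ * σ) '' X ∪ (σ * σ * σ) '' X := by
    rintro a ⟨x, hx, rfl | rfl | rfl | rfl⟩
    · exact Or.inl (Or.inl (Or.inl hx))
    · exact Or.inr ⟨_, hx, by simp only [Perm.mul_apply, hσ.apply_four]⟩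
    · exact Or.inl (Or.inr ⟨_, hx, by simp only [Perm.mul_apply, hσ.apply_four]⟩)
    · exact Or.inl (Or.inl (Or.inr ⟨_, hx, by simp only [hσ.apply_four]⟩))
  calc {a | ∃ x ∈ X, x ∈ vertex σ a}.ncard
      ≤ X.ncard + (σ '' X).ncard + ((σ * σ) '' X).ncard + ((σ * σ * σ) '' X).ncard :=
        (Set.ncard_le_ncard hsub).trans <| (Set.ncard_union_le _ _).trans <|
          Nat.add_le_add_right ((Set.ncard_union_le _ _).trans <|
            Nat.add_le_add_right (Set.ncard_union_le _ _) _) _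
    _ = 4 * X.ncard := by
        simp only [Set.ncard_image_of_injective _ (Equiv.injective _)]
        ring

theorem ncard_setOf_exists_mem_detachRegion_le (hσ : IsQuartic σ) (X : Set F) :
    {a | ∃ x ∈ X, x ∈ detachRegion σ τ a}.ncard ≤ 8 * X.ncard := by
  let T := {a | ∃ x ∈ X, x ∈ vertex σ a}
  have hsub : {a | ∃ x ∈ X, x ∈ detachRegion σ τ a} ⊆ T ∪ (τ * (σ * σ)).symm '' T := by
    rintro a ⟨x, hx, ha | ha⟩
    · exact Or.inl ⟨x, hx, ha⟩
    · exact Or.inr ⟨_, ⟨x, hx, ha⟩, Equiv.symm_apply_apply (τ * (σ * σ)) a⟩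
  have hle := (Set.ncard_le_ncard hsub).trans (Set.ncard_union_le _ _)
  rw [Set.ncard_image_of_injective _ (Equiv.injective _)] at hle
  have hT : T.ncard ≤ 4 * X.ncard := ncard_setOf_exists_mem_vertex_le hσ X
  omega

theorem IsCurve.le_ncard_detachable_of_far (h : IsCurve n σ τ) (hn : Nat.card F = 4 * n)
    (hn4 : 4 ≤ n) {X : Set F} (hX : 4992 * X.ncard ≤ n) :
    n ≤ 624 * {a | Detachable n σ τ a ∧ ∀ x ∈ X, x ∉ detachRegion σ τ a}.ncard := by
  have hdetach := h.le_ncard_detachable hn hn4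
  have hnear := ncard_setOf_exists_mem_detachRegion_le (τ := τ) h.quartic X
  have hsub : {a | Detachable n σ τ a} ⊆
      {a | Detachable n σ τ a ∧ ∀ x ∈ X, x ∉ detachRegion σ τ a} ∪
        {a | ∃ x ∈ X, x ∈ detachRegion σ τ a} := fun a ha => by
    by_cases hfar : ∀ x ∈ X, x ∉ detachRegion σ τ a
    · exact Or.inl ⟨ha, hfar⟩
    · push Not at hfar
      exact Or.inr hfar
  have hle := (Set.ncard_le_ncard hsub).trans (Set.ncard_union_le _ _)
  omega

/-- Double counting of the reattachments leading from `S` to `T`: each pair of `T` is reached from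
at most `52 * n` pairs of `S`. -/
theorem ncard_le_of_reattached [DecidableEq F] (hσ : IsQuartic σ) (hn : Nat.card F = 4 * n)
    (hn0 : 0 < n) {S T : Set (Perm F × F)} (hS : ∀ p ∈ S, IsPairing p.1)
    (hST : ∀ p ∈ S, n ≤ 624 * {a | ∃ κ, (κ, a) ∈ T ∧ Reattached n σ p.1 a p.2 κ}.ncard) :
    S.ncard ≤ 32448 * T.ncard := by
  classical
  have := Fintype.ofFinite F
  let r (p q : Perm F × F) : Prop := Reattached n σ p.1 q.2 p.2 q.1
  have habove : ∀ p ∈ S.toFinset, n ≤ 624 * (T.toFinset.bipartiteAbove r p).card := fun p hp => by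
    refine (hST p (Set.mem_toFinset.1 hp)).trans (Nat.mul_le_mul_left _ ?_)
    rw [← Set.ncard_coe_finset]
    refine (Set.ncard_le_ncard ?_).trans (Set.ncard_image_le (f := Prod.snd))
    rintro a ⟨κ, hκ, hr⟩
    exact ⟨(κ, a),
      Finset.mem_coe.2 ((Finset.mem_bipartiteAbove r).2 ⟨Set.mem_toFinset.2 hκ, hr⟩), rfl⟩
  have hbelow : ∀ q ∈ T.toFinset, (S.toFinset.bipartiteBelow r q).card ≤ 4 * n * 13 := fun q _ => by
    rw [← hn, ← Set.ncard_coe_finset]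
    refine (Set.ncard_le_ncard fun p hp => ?_).trans (ncard_reattached_le (n := n) hσ q.2 q.1)
    obtain ⟨hpS, hr⟩ := (Finset.mem_bipartiteBelow r).1 (Finset.mem_coe.1 hp)
    exact ⟨hS p (Set.mem_toFinset.1 hpS), hr⟩
  rw [Set.ncard_eq_toFinset_card', Set.ncard_eq_toFinset_card']
  refine Nat.le_of_mul_le_mul_right ?_ hn0
  calc S.toFinset.card * n
      ≤ ∑ p ∈ S.toFinset, 624 * (T.toFinset.bipartiteAbove r p).card := by
        rw [← smul_eq_mul, ← Finset.sum_const]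
        exact Finset.sum_le_sum habove
    _ = 624 * ∑ q ∈ T.toFinset, (S.toFinset.bipartiteBelow r q).card := by
        rw [← Finset.mul_sum, Finset.sum_card_bipartiteAbove_eq_sum_card_bipartiteBelow]
    _ ≤ 624 * (T.toFinset.card * (4 * n * 13)) := by
        gcongr
        rw [← smul_eq_mul (a := T.toFinset.card), ← Finset.sum_const]
        exact Finset.sum_le_sum hbelow
    _ = 32448 * T.toFinset.card * n := by ring

/-- The curves on the vertices of `σ` together with a flag that has a simple face of degree `j`. -/
def simpleFaces (n : ℕ) (σ : Perm F) (j : ℕ) : Set (Perm F × F) :=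
  {p | IsCurve n σ p.1 ∧ HasSimpleFace σ p.1 j p.2}

theorem ncard_isCurve_mul_le (hσ : IsQuartic σ) (hn : Nat.card F = 4 * n) (hn4 : 4992 ≤ n) :
    {τ : Perm F | IsCurve n σ τ}.ncard * (4 * n) ≤ 32448 * (simpleFaces n σ 1).ncard := by
  classical
  let T : Set (Perm F × F) := {p | IsCurve n σ p.1 ∧ HasSimpleFace σ p.1 1 ((σ * σ) p.2)}
  have hT : T.ncard ≤ (simpleFaces n σ 1).ncard :=
    Set.ncard_le_ncard_of_injOn (Prod.map id (σ * σ)) (fun _ hp => hp)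
      (Function.injective_id.prodMap (σ * σ).injective).injOn
  have hle := ncard_le_of_reattached (S := {τ | IsCurve n σ τ} ×ˢ Set.univ) (T := T) hσ hn
    (by omega) (fun p hp => hp.1.pairing) fun ⟨τ, b⟩ ⟨hτ, _⟩ => by
      refine (hτ.le_ncard_detachable_of_far hn (by omega) (X := {b})
        (by rwa [Set.ncard_singleton])).trans
        (Nat.mul_le_mul_left _ (Set.ncard_le_ncard fun a ha => ?_))
      obtain ⟨κ, hκ⟩ := ha.1.exists_reattached fun hb => ha.2 b rfl (Or.inl hb)
      exact ⟨κ, ⟨hκ.isCurve hσ, hκ.hasSimpleFace_one hσ⟩, hκ⟩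
  rw [Set.ncard_prod, Set.ncard_univ, hn] at hle
  exact hle.trans (Nat.mul_le_mul_left _ hT)

theorem ncard_simpleFaces_le (hσ : IsQuartic σ) (hn : Nat.card F = 4 * n) {j : ℕ} (hj : 0 < j)
    (hnj : 4992 * j ≤ n) :
    (simpleFaces n σ j).ncard ≤ 32448 * (simpleFaces n σ (j + 1)).ncard := by
  classical
  refine ncard_le_of_reattached hσ hn (by omega) (fun p hp => hp.1.pairing) ?_
  rintro ⟨τ, b⟩ ⟨hτ, hb⟩
  refine (hτ.le_ncard_detachable_of_far hn (by omega) (X := {y | SameCycle (σ * τ) b y})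
    (by rwa [ncard_sameCycle, hb.minimalPeriod_eq])).trans
    (Nat.mul_le_mul_left _ (Set.ncard_le_ncard fun a ha => ?_))
  have hfar : ∀ i, (σ * τ)^[i] b ∉ detachRegion σ τ a := fun i =>
    ha.2 _ ⟨i, by rw [zpow_natCast, ← Equiv.Perm.iterate_eq_pow]⟩
  obtain ⟨κ, hκ⟩ := ha.1.exists_reattached fun hb => hfar 0 (Or.inl hb)
  exact ⟨κ, ⟨hκ.isCurve hσ, hκ.hasSimpleFace_add_one hσ hb hfar⟩, hκ⟩

theorem ncard_isCurve_mul_le_pow_mul (hσ : IsQuartic σ) (hn : Nat.card F = 4 * n) {j : ℕ}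
    (hj : 0 < j) (hnj : 4992 * j ≤ n) :
    {τ : Perm F | IsCurve n σ τ}.ncard * (4 * n) ≤ 32448 ^ j * (simpleFaces n σ j).ncard := by
  induction j, hj using Nat.le_induction with
  | base => simpa only [pow_one] using ncard_isCurve_mul_le hσ hn (by omega)
  | succ j hj ih =>
    refine (ih (by omega)).trans ?_
    rw [pow_succ, mul_assoc]
    exact Nat.mul_le_mul_left _ (ncard_simpleFaces_le hσ hn hj (by omega))

end Transfer

section Transport

variable {F F' : Type*} {n : ℕ} {σ τ : Perm F}

theorem IsQuartic.permCongr (h : IsQuartic σ) (e : F ≃ F') : IsQuartic (e.permCongr σ) where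
  apply_apply_ne x := by
    simpa only [permCongr_apply, symm_apply_apply, ne_eq, ← eq_symm_apply]
      using h.apply_apply_ne (e.symm x)
  apply_four x := by
    simp only [permCongr_apply, symm_apply_apply, h.apply_four, apply_symm_apply]

theorem IsPairing.permCongr (h : IsPairing τ) (e : F ≃ F') : IsPairing (e.permCongr τ) where
  apply_ne x := by
    simpa only [permCongr_apply, ne_eq, ← eq_symm_apply] using h.apply_ne (e.symm x)
  apply_apply x := by
    simp only [permCongr_apply, symm_apply_apply, h.apply_apply, apply_symm_apply]

theorem JoinedOn.permCongr {s : Perm F} (h : JoinedOn Set.univ s τ) (e : F ≃ F') :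
    JoinedOn Set.univ (e.permCongr s) (e.permCongr τ) := by
  intro f hs hτ x _ y _ hx
  have hy := h (f ∘ e) (fun z _ => by simpa using hs (e z) trivial)
    (fun z _ => by simpa using hτ (e z) trivial) (e.symm x) trivial (e.symm y) trivial
    (by simpa using hx)
  simpa using hy

theorem numCycles_le_numCycles_permCongr [Finite F'] (φ : Perm F) (e : F ≃ F') :
    numCycles φ ≤ numCycles (e.permCongr φ) :=
  card_le_numCycles_of_surjective (f := cycleAt φ ∘ e.symm)
    (fun x => by simp [cycleAt_apply φ])
    (Quotient.mk_surjective.comp e.symm.surjective)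

theorem IsCurve.permCongr [Finite F'] (h : IsCurve n σ τ) (e : F ≃ F') :
    IsCurve n (e.permCongr σ) (e.permCongr τ) where
  quartic := h.quartic.permCongr e
  pairing := h.pairing.permCongr e
  joined := by
    rw [← permCongr_mul]
    exact h.joined.permCongr e
  le_faces := by
    rw [← permCongr_mul]
    exact h.le_faces.trans (numCycles_le_numCycles_permCongr _ e)

theorem JoinedOn.isPretransitive {s : Perm F} {H : Subgroup (Perm F)}
    (h : JoinedOn Set.univ s τ) (hs : s ∈ H) (hτ : τ ∈ H) : MulAction.IsPretransitive H F where
  exists_smul_eq x y := MulAction.orbit_eq_iff.1 <|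
    h (fun z => MulAction.orbit H z = MulAction.orbit H x)
      (fun z _ => by rw [← MulAction.orbit_smul (⟨s, hs⟩ : H) z]; rfl)
      (fun z _ => by rw [← MulAction.orbit_smul (⟨τ, hτ⟩ : H) z]; rfl)
      x trivial y trivial rfl

/-- The labelled curve with vertices `σ`, edges `τ` and root `a`. -/
def IsCurve.toLabelledCurve {σ τ : Perm (Fin (4 * n))} (h : IsCurve n σ τ) (a : Fin (4 * n)) :
    LabelledCurve n where
  σ := σ
  τ := τ
  root := a
  vertices := (cycleType_eq_replicate_iff (by norm_num) (Fintype.card_fin _)).2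
    (isQuartic_iff_minimalPeriod.1 h.quartic)
  edges := (cycleType_eq_replicate_iff le_rfl (by rw [Fintype.card_fin]; ring)).2
    (isPairing_iff_minimalPeriod.1 h.pairing)
  connected :=
    have hσ : σ ∈ Subgroup.closure {σ, τ} := Subgroup.subset_closure (by simp)
    h.joined.isPretransitive (mul_mem hσ hσ) (Subgroup.subset_closure (by simp))
  planar := by
    have : Nonempty (Fin (4 * n)) := ⟨a⟩
    rw [card_parts_partition, h.numCycles_eq (Nat.card_fin _)]
  curve := by
    have : Nonempty (Fin (4 * n)) := ⟨a⟩
    rw [card_parts_partition, pow_two,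
      (joinedOn_univ_iff_numCycles_eq_two h.quartic.isOpposite.isPairing h.pairing).1 h.joined]

end Transport

section Circle

variable (n : ℕ)

/-- The vertex permutation of a circle with `n` kinks: `(i, r)` is the `r`-th flag of the `i`-th
crossing. -/
def circleVertices : Perm (ZMod n × Fin 4) where
  toFun x := (x.1, x.2 + 1)
  invFun x := (x.1, x.2 - 1)
  left_inv x := by simp only [add_sub_cancel_right]
  right_inv x := by simp only [sub_add_cancel]

/-- The other end of the edge of a flag of a circle with `n` kinks: flags `1` and `2` of each
crossing bound a loop, and flag `3` is joined to flag `0` of the next crossing. -/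
def circleEdgesFun : ZMod n × Fin 4 → ZMod n × Fin 4
  | (i, 0) => (i - 1, 3)
  | (i, 1) => (i, 2)
  | (i, 2) => (i, 1)
  | (i, 3) => (i + 1, 0)

theorem circleEdgesFun_involutive : Function.Involutive (circleEdgesFun n) := by
  rintro ⟨i, r⟩
  fin_cases r <;> simp [circleEdgesFun]

/-- The edge permutation of a circle with `n` kinks. -/
def circleEdges : Perm (ZMod n × Fin 4) := (circleEdgesFun_involutive n).toPerm

/-- The face of a flag of a circle with `n` kinks: the loop of one of the kinks, or one of the two
sides of the circle. -/
def circleFace : ZMod n × Fin 4 → ZMod n ⊕ Bool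
  | (_, 0) => Sum.inr false
  | (_, 1) => Sum.inr true
  | (i, 2) => Sum.inl i
  | (_, 3) => Sum.inr true

theorem circleFace_apply (x : ZMod n × Fin 4) :
    circleFace n ((circleVertices n * circleEdges n) x) = circleFace n x := by
  obtain ⟨i, r⟩ := x
  fin_cases r <;> simp [circleVertices, circleEdges, circleEdgesFun, circleFace]

theorem circleFace_surjective : Function.Surjective (circleFace n) := by
  rintro (i | _ | _)
  exacts [⟨(i, 2), rfl⟩, ⟨(0, 0), rfl⟩, ⟨(0, 1), rfl⟩]

variable [NeZero n]

theorem joinedOn_circle :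
    JoinedOn Set.univ (circleVertices n * circleVertices n) (circleEdges n) := by
  intro f hs hτ
  have h02 : ∀ i, f (i, 2) ↔ f (i, 0) := fun i => hs (i, 0) trivial
  have h13 : ∀ i, f (i, 3) ↔ f (i, 1) := fun i => hs (i, 1) trivial
  have h12 : ∀ i, f (i, 2) ↔ f (i, 1) := fun i => hτ (i, 1) trivial
  have h30 : ∀ i, f (i + 1, 0) ↔ f (i, 3) := fun i => hτ (i, 3) trivial
  have hnat : ∀ m : ℕ, f ((m : ZMod n), 0) ↔ f (0, 0) := by
    intro m
    induction m with
    | zero => rw [Nat.cast_zero]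
    | succ m ih => rw [Nat.cast_succ, h30, h13, ← h12, h02, ih]
  have hzero : ∀ i, f (i, 0) ↔ f (0, 0) := fun i => by
    simpa only [ZMod.natCast_zmod_val] using hnat i.val
  have hall : ∀ x, f x ↔ f (0, 0) := by
    rintro ⟨i, r⟩
    fin_cases r
    · exact hzero i
    · exact (h12 i).symm.trans ((h02 i).trans (hzero i))
    · exact (h02 i).trans (hzero i)
    · exact (h13 i).trans ((h12 i).symm.trans ((h02 i).trans (hzero i)))
  exact fun x _ y _ hx => (hall y).2 ((hall x).1 hx)

theorem isCurve_circle : IsCurve n (circleVertices n) (circleEdges n) where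
  quartic :=
    { apply_apply_ne := by
        rintro ⟨i, r⟩
        fin_cases r <;> simp [circleVertices]
      apply_four := by
        rintro ⟨i, r⟩
        fin_cases r <;> simp [circleVertices] }
  pairing :=
    { apply_ne := by
        rintro ⟨i, r⟩
        fin_cases r <;> simp [circleEdges, circleEdgesFun]
      apply_apply := circleEdgesFun_involutive n }
  joined := joinedOn_circle n
  le_faces := by
    simpa using card_le_numCycles_of_surjective (circleFace_apply n) (circleFace_surjective n)

theorem nonempty_labelledCurve : Nonempty (LabelledCurve n) := by
  have hcard : Fintype.card (ZMod n × Fin 4) = 4 * n := by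
    rw [Fintype.card_prod, ZMod.card, Fintype.card_fin, mul_comm]
  exact ⟨((isCurve_circle n).permCongr (Fintype.equivFinOfCardEq hcard)).toLabelledCurve
    ⟨0, mul_pos four_pos (NeZero.pos n)⟩⟩

end Circle

section Count

variable {F : Type*} [Fintype F] [DecidableEq F] {n : ℕ}

open Classical in
theorem ncard_simpleFaces_le_mul_sum_count (σ : Perm F) (k : ℕ) :
    (simpleFaces n σ k).ncard ≤
      k * ∑ τ with IsCurve n σ τ, (σ * τ).partition.parts.count k := by
  calc (simpleFaces n σ k).ncard
      ≤ Set.ncard {p : Perm F × F | IsCurve n σ p.1 ∧ Function.minimalPeriod (σ * p.1) p.2 = k} :=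
        Set.ncard_le_ncard fun p hp => ⟨hp.1, hp.2.minimalPeriod_eq⟩
    _ = ∑ τ : Perm F, ∑ x : F,
          if IsCurve n σ τ ∧ Function.minimalPeriod (σ * τ) x = k then 1 else 0 := by
        rw [Set.ncard_eq_toFinset_card', Set.toFinset_ofPred, Finset.card_filter,
          Fintype.sum_prod_type]
    _ = k * ∑ τ with IsCurve n σ τ, (σ * τ).partition.parts.count k := by
        rw [Finset.mul_sum, Finset.sum_filter]
        simp only [mul_count_partition, Finset.card_filter, ite_and, Finset.sum_ite_irrel,
          Finset.sum_const_zero]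

open Classical in
theorem card_isCurve_mul_le_pow_mul_sum_count (σ : Perm F) (hn : Nat.card F = 4 * n) {k : ℕ}
    (hk : 0 < k) (hnk : 4992 * k ≤ n) :
    (Finset.univ.filter (IsCurve n σ)).card * (4 * n) ≤
      32448 ^ k * (k * ∑ τ with IsCurve n σ τ, (σ * τ).partition.parts.count k) := by
  by_cases hσ : IsQuartic σ
  · have hle := ncard_isCurve_mul_le_pow_mul hσ hn hk hnk
    rw [Set.ncard_eq_toFinset_card', Set.toFinset_ofPred] at hle
    exact hle.trans (Nat.mul_le_mul_left _ (ncard_simpleFaces_le_mul_sum_count σ k))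
  · have hempty : Finset.univ.filter (IsCurve n σ) = ∅ :=
      Finset.filter_eq_empty_iff.2 fun _ _ h => hσ h.quartic
    simp [hempty]

end Count

end PlaneCurve

namespace LabelledCurve

open Equiv Equiv.Perm PlaneCurve

variable {n : ℕ}

noncomputable instance fintype (n : ℕ) : Fintype (LabelledCurve n) := Fintype.ofFinite _

theorem isCurve (C : LabelledCurve n) : IsCurve n C.σ C.τ := by
  have hσ : IsQuartic C.σ := isQuartic_iff_minimalPeriod.2
    ((cycleType_eq_replicate_iff (by norm_num) (Fintype.card_fin _)).1 C.vertices)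
  have hτ : IsPairing C.τ := isPairing_iff_minimalPeriod.2
    ((cycleType_eq_replicate_iff le_rfl (by rw [Fintype.card_fin]; ring)).1 C.edges)
  have : Nonempty (Fin (4 * n)) := ⟨C.root⟩
  refine ⟨hσ, hτ, (joinedOn_univ_iff_numCycles_eq_two hσ.isOpposite.isPairing hτ).2 ?_, ?_⟩
  · rw [← card_parts_partition, ← pow_two]
    exact C.curve
  · rw [← card_parts_partition, C.planar]

theorem ext_of_eq {C D : LabelledCurve n} (hσ : C.σ = D.σ) (hτ : C.τ = D.τ)
    (hroot : C.root = D.root) : C = D := by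
  cases C; cases D; simp_all only

/-- The curve obtained from `C` by renaming its flags along `g`. -/
def relabel (C : LabelledCurve n) (g : Perm (Fin (4 * n))) : LabelledCurve n :=
  (C.isCurve.permCongr g).toLabelledCurve (g C.root)

theorem iso_iff_mem_range_relabel {C D : LabelledCurve n} : Iso C D ↔ D ∈ Set.range C.relabel :=
  ⟨fun ⟨g, hσ, hτ, hroot⟩ => ⟨g, ext_of_eq hσ.symm hτ.symm hroot.symm⟩,
    fun ⟨g, hg⟩ => hg ▸ ⟨g, rfl, rfl, rfl⟩⟩

/-- Two relabellings that agree at the root agree along the whole curve. -/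
theorem relabel_injective (C : LabelledCurve n) : Function.Injective C.relabel := by
  intro g g' h
  have hcomm : ∀ π : Perm (Fin (4 * n)), g.permCongr π = g'.permCongr π →
      ∀ z, g (π z) = g' (π z) ↔ g z = g' z := by
    intro π hπ z
    have hg : g (π z) = g.permCongr π (g z) := by simp
    have hg' : g' (π z) = g.permCongr π (g' z) := by rw [hπ]; simp
    rw [hg, hg', EmbeddingLike.apply_eq_iff_eq]
  have hσ := hcomm C.σ (congrArg LabelledCurve.σ h)
  have hτ := hcomm C.τ (congrArg LabelledCurve.τ h)
  exact Equiv.ext fun z => C.isCurve.joined (fun z => g z = g' z)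
    (fun z _ => (hσ (C.σ z)).trans (hσ z)) (fun z _ => hτ z) C.root trivial z trivial
    (congrArg LabelledCurve.root h)

/-- The rooted plane curve of a labelled curve. -/
def toRootedPlaneCurve (C : LabelledCurve n) : RootedPlaneCurve n := Quotient.mk _ C

theorem toRootedPlaneCurve_surjective :
    Function.Surjective (toRootedPlaneCurve : LabelledCurve n → RootedPlaneCurve n) :=
  Quotient.mk_surjective

theorem toRootedPlaneCurve_eq_iff {C D : LabelledCurve n} :
    C.toRootedPlaneCurve = D.toRootedPlaneCurve ↔ C ∈ Set.range D.relabel := by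
  rw [eq_comm, ← iso_iff_mem_range_relabel]
  exact Quotient.eq

open Classical in
theorem card_toRootedPlaneCurve_eq (D : RootedPlaneCurve n) :
    (Finset.univ.filter fun C : LabelledCurve n => C.toRootedPlaneCurve = D).card =
      (4 * n).factorial := by
  obtain ⟨C, rfl⟩ := toRootedPlaneCurve_surjective D
  have hfiber : (Finset.univ.filter fun C' : LabelledCurve n =>
      C'.toRootedPlaneCurve = C.toRootedPlaneCurve) = Finset.univ.image C.relabel := by
    ext C'
    simp only [Finset.mem_filter, Finset.mem_univ, true_and, Finset.mem_image,
      toRootedPlaneCurve_eq_iff, Set.mem_range]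
  rw [hfiber, Finset.card_image_of_injective _ C.relabel_injective, Finset.card_univ,
    Fintype.card_perm, Fintype.card_fin]

theorem sum_toRootedPlaneCurve (f : RootedPlaneCurve n → ℝ) :
    ∑ C : LabelledCurve n, f C.toRootedPlaneCurve = (4 * n).factorial * ∑ D, f D := by
  classical
  rw [← Finset.sum_fiberwise' Finset.univ toRootedPlaneCurve, Finset.mul_sum]
  refine Finset.sum_congr rfl fun D _ => ?_
  rw [Finset.sum_const, card_toRootedPlaneCurve_eq, nsmul_eq_mul]

/-- A labelled curve consists of its vertices, its edges and its root. -/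
def equivSigma (n : ℕ) : LabelledCurve n ≃
    (σ : Perm (Fin (4 * n))) × {τ : Perm (Fin (4 * n)) // IsCurve n σ τ} × Fin (4 * n) where
  toFun C := ⟨C.σ, ⟨C.τ, C.isCurve⟩, C.root⟩
  invFun x := x.2.1.2.toLabelledCurve x.2.2
  left_inv _ := rfl
  right_inv _ := rfl

open Classical in
theorem sum_eq_sum_isCurve (f : Perm (Fin (4 * n)) → Perm (Fin (4 * n)) → ℕ) :
    ∑ C : LabelledCurve n, f C.σ C.τ = ∑ σ, 4 * n * ∑ τ with IsCurve n σ τ, f σ τ := by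
  rw [Fintype.sum_equiv (equivSigma n) (fun C => f C.σ C.τ) (fun x => f x.1 x.2.1)
    fun _ => rfl, Fintype.sum_sigma]
  refine Finset.sum_congr rfl fun σ _ => ?_
  simp only [Fintype.sum_prod_type, Finset.sum_const, Finset.card_univ, Fintype.card_fin,
    smul_eq_mul, ← Finset.mul_sum]
  rw [Finset.sum_subtype (p := IsCurve n σ) _ (by simp)]

theorem mul_card_le_pow_mul_sum_count {k : ℕ} (hk : 0 < k) (hnk : 4992 * k ≤ n) :
    4 * n * Fintype.card (LabelledCurve n) ≤
      32448 ^ k * (k * ∑ C : LabelledCurve n, C.faceDegrees.count k) := by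
  classical
  calc 4 * n * Fintype.card (LabelledCurve n)
      = ∑ σ, 4 * n * ((Finset.univ.filter (IsCurve n σ)).card * (4 * n)) := by
        rw [← Finset.card_univ, Finset.card_eq_sum_ones, sum_eq_sum_isCurve fun _ _ => 1,
          Finset.mul_sum]
        simp only [← Finset.card_eq_sum_ones, mul_comm]
    _ ≤ ∑ σ, 4 * n * (32448 ^ k *
          (k * ∑ τ with IsCurve n σ τ, (σ * τ).partition.parts.count k)) :=
        Finset.sum_le_sum fun σ _ => Nat.mul_le_mul_left _
          (card_isCurve_mul_le_pow_mul_sum_count σ (Nat.card_fin _) hk hnk)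
    _ = 32448 ^ k * (k * ∑ C : LabelledCurve n, (C.σ * C.τ).partition.parts.count k) := by
        rw [sum_eq_sum_isCurve fun σ τ => (σ * τ).partition.parts.count k, Finset.mul_sum,
          Finset.mul_sum]
        exact Finset.sum_congr rfl fun σ _ => by ring

end LabelledCurve

namespace RootedPlaneCurve

theorem numFaces_eq {n : ℕ} (D : RootedPlaneCurve n) : D.numFaces = n + 2 := by
  obtain ⟨C, rfl⟩ := Quotient.exists_rep D
  exact C.planar

theorem faceProb_eq (n k : ℕ) : faceProb n k = expectedFaceCount n k / (n + 2) := by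
  simp only [faceProb, expectedFaceCount, Finset.expect_div, numFaces_eq, Nat.cast_add,
    Nat.cast_ofNat]

theorem expectedFaceCount_eq (n k : ℕ) :
    expectedFaceCount n k =
      (∑ C : LabelledCurve n, (C.faceDegrees.count k : ℝ)) / Fintype.card (LabelledCurve n) := by
  have hcount := LabelledCurve.sum_toRootedPlaneCurve fun D : RootedPlaneCurve n =>
    (D.faceCount k : ℝ)
  have hcard : (Fintype.card (LabelledCurve n) : ℝ) =
      (4 * n).factorial * Fintype.card (RootedPlaneCurve n) := by
    simpa using LabelledCurve.sum_toRootedPlaneCurve (n := n) fun _ => 1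
  have hfactorial : ((4 * n).factorial : ℝ) ≠ 0 := Nat.cast_ne_zero.2 (Nat.factorial_ne_zero _)
  rw [expectedFaceCount, Fintype.expect_eq_sum_div_card, hcard,
    ← mul_div_mul_left _ _ hfactorial, ← hcount]
  rfl

theorem faceProb_nonneg (n k : ℕ) : 0 ≤ faceProb n k :=
  Finset.expect_nonneg fun _ _ => by positivity

theorem faceCount_add_faceCount_le {n : ℕ} (D : RootedPlaneCurve n) {k l : ℕ} (hkl : k ≠ l) :
    D.faceCount k + D.faceCount l ≤ D.numFaces := by
  classical
  rw [numFaces, faceCount, faceCount, ← Finset.sum_pair (f := D.faceDegrees.count) hkl,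
    ← Multiset.sum_count_eq_card (s := {k, l} ∪ D.faceDegrees.toFinset) (m := D.faceDegrees)
      (by simp +contextual)]
  exact Finset.sum_le_sum_of_subset Finset.subset_union_left

theorem faceProb_add_faceProb_le_one (n : ℕ) {k l : ℕ} (hkl : k ≠ l) :
    faceProb n k + faceProb n l ≤ 1 := by
  rw [faceProb, faceProb, ← Finset.expect_add_distrib, Fintype.expect_eq_sum_div_card]
  refine div_le_one_of_le₀ ?_ (Nat.cast_nonneg _)
  rw [← nsmul_one, ← Finset.card_univ]
  refine Finset.sum_le_card_nsmul _ _ _ fun D _ => ?_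
  rw [← add_div]
  exact div_le_one_of_le₀ (by exact_mod_cast D.faceCount_add_faceCount_le hkl)
    (Nat.cast_nonneg _)

theorem one_div_le_faceProb {n k : ℕ} (hk : 0 < k) (hnk : 4992 * k ≤ n) :
    1 / (32448 ^ k * (k : ℝ)) ≤ faceProb n k := by
  have : NeZero n := ⟨by omega⟩
  have := PlaneCurve.nonempty_labelledCurve n
  have hn : (1 : ℝ) ≤ n := Nat.one_le_cast.2 NeZero.one_le
  rw [faceProb_eq, expectedFaceCount_eq, div_div, div_le_div_iff₀ (by positivity)
    (mul_pos (Nat.cast_pos.2 Fintype.card_pos) (by positivity)), one_mul]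
  calc (Fintype.card (LabelledCurve n) : ℝ) * (n + 2)
      ≤ Fintype.card (LabelledCurve n) * (4 * n) := by gcongr; linarith
    _ = 4 * n * Fintype.card (LabelledCurve n) := by ring
    _ ≤ 32448 ^ k * (k * ∑ C : LabelledCurve n, (C.faceDegrees.count k : ℝ)) := by
        exact_mod_cast LabelledCurve.mul_card_le_pow_mul_sum_count hk hnk
    _ = _ := by ring

end RootedPlaneCurve

theorem mainTheorem5 (k : ℕ) (hk : 1 ≤ k) :
    (∀ n : ℕ, 1 ≤ n →
      ((n : ℝ) + 2) * RootedPlaneCurve.faceProb n k = RootedPlaneCurve.expectedFaceCount n k) ∧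
    0 < liminf (fun n : ℕ => RootedPlaneCurve.faceProb n k) atTop ∧
    liminf (fun n : ℕ => RootedPlaneCurve.faceProb n k) atTop ≤
      limsup (fun n : ℕ => RootedPlaneCurve.faceProb n k) atTop ∧
    limsup (fun n : ℕ => RootedPlaneCurve.faceProb n k) atTop < 1 := by
  have hadd := fun n => RootedPlaneCurve.faceProb_add_faceProb_le_one n (Nat.lt_add_one k).ne
  have hnonneg := RootedPlaneCurve.faceProb_nonneg
  have habove : IsBoundedUnder (· ≤ ·) atTop fun n => RootedPlaneCurve.faceProb n k :=
    isBoundedUnder_of ⟨1, fun n => by linarith [hadd n, hnonneg n (k + 1)]⟩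
  have hbelow : IsBoundedUnder (· ≥ ·) atTop fun n => RootedPlaneCurve.faceProb n k :=
    isBoundedUnder_of ⟨0, fun n => hnonneg n k⟩
  refine ⟨fun n _ => ?_, ?_, liminf_le_limsup habove hbelow, ?_⟩
  · rw [RootedPlaneCurve.faceProb_eq, mul_div_cancel₀ _ (by positivity)]
  · refine lt_of_lt_of_le (b := 1 / (32448 ^ k * (k : ℝ))) (by positivity)
      (le_liminf_of_le habove.isCoboundedUnder_ge ?_)
    filter_upwards [eventually_ge_atTop (4992 * k)] with n hn
    exact RootedPlaneCurve.one_div_le_faceProb hk hn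
  · refine lt_of_le_of_lt (b := 1 - 1 / (32448 ^ (k + 1) * ((k + 1 : ℕ) : ℝ)))
      (limsup_le_of_le hbelow.isCoboundedUnder_le ?_) (sub_lt_self _ (by positivity))
    filter_upwards [eventually_ge_atTop (4992 * (k + 1))] with n hn
    linarith [hadd n, RootedPlaneCurve.one_div_le_faceProb k.add_one_pos hn]
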